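/- A cograph is a graph with no induced path on four vertices. The following decision problem can be solved in polynomial time. Given a finite simple undirected graph $G$, decide whether $V(G)$ can be partitioned into two sets $V_1, V_2$ such that, with $G_1 = G[V_1]$ and $G_2 = G[V_2]$, the graph $G_2$ is isomorphic to the complement $\overline{G_1}$ of $G_1$, the graph $G_1$ is a cograph, and the edge cut $[V_1, V_2]$ (the set of edges of $G$ with one end in $V_1$ and the other in $V_2$) is a perfect matching of $G$. That is, there are a Turing machine and a polynomial $p$ such that for every $n \ge 0$ and every graph $G$ on $n$ vertices, given by its adjacency matrix, the machine halts with the correct answer after at most $p(\ell)$ steps, where $\ell = n(n+1)$ is the length of the encoding of $G$ (row by row, with an end marker after each row). -/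

import Mathlib

/-- A cograph is a graph without an induced path on four vertices. -/
def IsCograph {V : Type*} (G : SimpleGraph V) : Prop :=
  IsEmpty (SimpleGraph.pathGraph 4 ↪g G)

/-- The edge cut `[V₁, V₂]` as a spanning subgraph of `G`: all vertices of `G`, and exactly the
edges of `G` with one end in `V₁` and the other in `V₂`. -/
def edgeCut {V : Type*} (G : SimpleGraph V) (V₁ V₂ : Set V) : G.Subgraph where
  verts := Set.univ
  Adj u v := G.Adj u v ∧ (u ∈ V₁ ∧ v ∈ V₂ ∨ u ∈ V₂ ∧ v ∈ V₁)
  adj_sub h := h.1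
  edge_vert _ := Set.mem_univ _
  symm := ⟨fun _ _ h => ⟨h.1.symm, h.2.elim (fun a => Or.inr ⟨a.2, a.1⟩)
    (fun a => Or.inl ⟨a.2, a.1⟩)⟩⟩

/-- `G` can be decomposed into a cograph `G₁` and (a graph isomorphic to) the complement `G₂` of
`G₁` in such a way that the edge cut of the decomposition is a perfect matching: the vertex set is
partitioned into `V₁` and `V₂` with `G₁ = G[V₁]` and `G₂ = G[V₂]`. -/
def HasCographDecomposition {V : Type*} (G : SimpleGraph V) : Prop :=
  ∃ V₁ V₂ : Set V, IsCompl V₁ V₂ ∧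
    Nonempty (G.induce V₂ ≃g (G.induce V₁)ᶜ) ∧
    IsCograph (G.induce V₁) ∧
    (edgeCut G V₁ V₂).IsPerfectMatching

/-- The inputs: finite simple graphs, with vertices numbered `0, …, n - 1`. -/
abbrev InputGraph : Type := Σ n : ℕ, SimpleGraph (Fin n)

open scoped Classical in
/-- The adjacency matrix of the input graph, written row by row as a word: `some true` and
`some false` are the entries `1` and `0`, and `none` marks the end of a row.
A graph with `n` vertices gives a word of length `n * (n + 1)`. -/
noncomputable def encodeGraph (G : InputGraph) : List (Option Bool) :=
  (List.finRange G.1).flatMap fun i =>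
    (List.finRange G.1).map (fun j => some (decide (G.2.Adj i j))) ++ [none]

open scoped Classical in
/-- The decision problem `P` on objects encoded as words by `enc` is solvable in polynomial time:
one Turing machine (with finitely many stacks in the role of tapes, all over finite alphabets)
halts on every input `enc a` after a number of steps bounded by a fixed polynomial in the length
of `enc a`, and outputs the truth value of `P a`. -/
def PolyTimeDecidable {α Γ : Type} (enc : α → List Γ) (P : α → Prop) : Prop :=
  ∃ M : Turing.TM2ComputableInPolyTime enc Computability.encodeBool (fun a => decide (P a)),
    ∀ k, Finite (M.tm.Γ k)

/-! Few candidates for the partition. Call `V₁ = A`. A cograph with at least two vertices is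
disconnected or has a disconnected complement (`exists_split`). If the complement of `G[A]` is
disconnected, two vertices `x`, `y` of `A` from different co-components have all of `A` in the union
of their neighbourhoods. Each of them has exactly one neighbour outside `A`, its partner in the
matching, so `A` is `N(x) ∪ N(y)` without two vertices. If `G[A]` is disconnected, the same holds
for the other side, whose graph is the complement. The situation is symmetric in the two sides
(`Good.compl`), so at most `n ^ 4` sets have to be tested (`Good.exists_candidate`).

Testing a candidate. Let `K` consist of the edges inside `A` and the non-edges inside its
complement. As the path on four vertices is self-complementary, the conditions become: the cut is a
perfect matching, `K` is free of induced four-vertex paths, and the two sides are isomorphic for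
`K`. Isomorphism of cographs is tested on the cotree: classes are split repeatedly into components
and co-components (`level`), reaching single vertices after fewer than `n` rounds (`level_trivial`).
Two classes are isomorphic iff they are split in the same way, as a disjoint union or as a join, and
their parts realise each isomorphism type equally often (`test_iff_classIso`).

Polynomial time. In a graph without induced four-vertex paths, connected means distance at most two,
so one splitting step is first-order definable; the comparison of parts needs only a counting
quantifier. The whole test is thus a fixed formula over tables of bounded arity, filled by applying
two definitions `n` times each. Formulas are evaluated by nested loops of polynomial length
(`runs_evalCmd`), and the loop programs are compiled to a machine whose running time is tracked
exactly enough for a polynomial bound (`polyTimeDecidable_of_rules`). -/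

namespace StackProgram

/-! ### Structured stack programs and their compilation to machines. -/

open Function Turing StateTransition

variable {K : Type} {Γ : K → Type}

/-- Structured programs working on finitely many stacks. -/
inductive Cmd (Γ : K → Type) : Type
  | push (k : K) (s : Γ k) : Cmd Γ
  | pop (k : K) : Cmd Γ
  | seq (a b : Cmd Γ) : Cmd Γ
  | ite (k : K) (p : Option (Γ k) → Bool) (a b : Cmd Γ) : Cmd Γ
  | loop (k : K) (a : Cmd Γ) : Cmd Γ

/-- The control points of a program. -/
def Lab : Cmd Γ → Type
  | .push _ _ => Unit
  | .pop _ => Unit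
  | .seq a b => Lab a ⊕ Lab b
  | .ite _ _ a b => Option (Lab a ⊕ Lab b)
  | .loop _ a => Option (Lab a)

/-- The control point at which a program starts. -/
def Lab.entry : (c : Cmd Γ) → Lab c
  | .push _ _ => ()
  | .pop _ => ()
  | .seq a _ => Sum.inl (Lab.entry a)
  | .ite _ _ _ _ => none
  | .loop _ _ => none

theorem finite_lab (c : Cmd Γ) : Finite (Lab c) := by
  induction c with
  | push => exact inferInstanceAs (Finite Unit)
  | pop => exact inferInstanceAs (Finite Unit)
  | seq a b iha ihb => exact inferInstanceAs (Finite (Lab a ⊕ Lab b))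
  | ite k p a b iha ihb => exact inferInstanceAs (Finite (Option (Lab a ⊕ Lab b)))
  | loop k a iha => exact inferInstanceAs (Finite (Option (Lab a)))

/-- The machine statement at each control point, for a program whose control points are embedded
into the labels `Λ` of a machine and which continues at `exit`. -/
def code {Λ : Type} : (c : Cmd Γ) → (Lab c → Λ) → Λ → Lab c → TM2.Stmt Γ Λ Bool
  | .push k s, _, exit, _ => .push k (fun _ => s) (.goto fun _ => exit)
  | .pop k, _, exit, _ => .pop k (fun v _ => v) (.goto fun _ => exit)
  | .seq a b, emb, exit, l =>
    Sum.elim (code a (fun l => emb (Sum.inl l)) (emb (Sum.inr (Lab.entry b))))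
      (code b (fun l => emb (Sum.inr l)) exit) l
  | .ite k p a b, emb, exit, l =>
    Option.elim l
      (.peek k (fun _ s => p s) (.branch id (.goto fun _ => emb (some (Sum.inl (Lab.entry a))))
        (.goto fun _ => emb (some (Sum.inr (Lab.entry b))))))
      (Sum.elim (code a (fun l => emb (some (Sum.inl l))) exit)
        (code b (fun l => emb (some (Sum.inr l))) exit))
  | .loop k a, emb, exit, l =>
    Option.elim l
      (.peek k (fun _ s => s.isSome) (.branch id (.goto fun _ => emb (some (Lab.entry a)))
        (.goto fun _ => exit)))
      (code a (fun l => emb (some l)) (emb none))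

variable [DecidableEq K]

/-- `Runs c S S' t`: started on the stacks `S`, the program `c` ends with the stacks `S'` after at
most `t` steps. -/
inductive Runs : Cmd Γ → (∀ k, List (Γ k)) → (∀ k, List (Γ k)) → ℕ → Prop
  | push {k s S} : Runs (.push k s) S (update S k (s :: S k)) 1
  | pop {k S} : Runs (.pop k) S (update S k (S k).tail) 1
  | seq {a b S S' S'' t t'} : Runs a S S' t → Runs b S' S'' t' → Runs (.seq a b) S S'' (t + t')
  | ite_true {k p a b S S' t} : p (S k).head? = true → Runs a S S' t →
      Runs (.ite k p a b) S S' (t + 1)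
  | ite_false {k p a b S S' t} : p (S k).head? = false → Runs b S S' t →
      Runs (.ite k p a b) S S' (t + 1)
  | loop_nil {k a S} : S k = [] → Runs (.loop k a) S S 1
  | loop_cons {k a S S' S'' t t'} : S k ≠ [] → Runs a S S' t → Runs (.loop k a) S' S'' t' →
      Runs (.loop k a) S S'' (1 + t + t')
  | weaken {a S S' t t'} : Runs a S S' t → t ≤ t' → Runs a S S' t'

/-- Reachability of a configuration in at most `t` steps. -/
def ReachesIn {α : Type} (f : α → Option α) (a b : α) (t : ℕ) : Prop :=
  ∃ s ≤ t, (flip bind f)^[s] (some a) = some b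

theorem ReachesIn.trans {α : Type} {f : α → Option α} {a b c : α} {t t' : ℕ}
    (h : ReachesIn f a b t) (h' : ReachesIn f b c t') : ReachesIn f a c (t + t') := by
  obtain ⟨s, hs, h⟩ := h
  obtain ⟨s', hs', h'⟩ := h'
  refine ⟨s' + s, by omega, ?_⟩
  rw [iterate_add_apply, h, h']

theorem ReachesIn.single {α : Type} {f : α → Option α} {a b : α} (h : f a = some b) :
    ReachesIn f a b 1 := ⟨1, le_rfl, h⟩

/-- Induction on the run. Embedding and exit stay general because a subprogram sits inside a larger
label type. The register on entry is arbitrary: every branch is preceded by a peek that overwrites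
it. -/
theorem Runs.reachesIn {c : Cmd Γ} {S S' : ∀ k, List (Γ k)} {t : ℕ} (h : Runs c S S' t) :
    ∀ {Λ : Type} {M : Λ → TM2.Stmt Γ Λ Bool} {emb : Lab c → Λ} {exit : Λ},
      (∀ l, M (emb l) = code c emb exit l) → ∀ v, ∃ v',
        ReachesIn (TM2.step M) ⟨some (emb (Lab.entry c)), v, S⟩ ⟨some exit, v', S'⟩ t := by
  induction h with
  | push =>
    intro Λ M emb exit hM v
    exact ⟨v, .single (by simp [TM2.step, hM, code])⟩
  | pop =>
    intro Λ M emb exit hM v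
    exact ⟨v, .single (by simp [TM2.step, hM, code])⟩
  | seq _ _ iha ihb =>
    intro Λ M emb exit hM v
    obtain ⟨v', h⟩ := iha (fun l => hM (Sum.inl l)) v
    obtain ⟨v'', h'⟩ := ihb (fun l => hM (Sum.inr l)) v'
    exact ⟨v'', h.trans h'⟩
  | @ite_true k p a b S S' t hp _ ih =>
    intro Λ M emb exit hM v
    obtain ⟨v', h⟩ := ih (emb := fun l => emb (some (Sum.inl l))) (fun l => hM (some (Sum.inl l)))
      true
    refine ⟨v', ?_⟩
    rw [add_comm]
    refine .trans (.single ?_) h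
    change some (TM2.stepAux (M (emb none)) v S) = _
    simp [hM none, code, hp]
  | @ite_false k p a b S S' t hp _ ih =>
    intro Λ M emb exit hM v
    obtain ⟨v', h⟩ := ih (emb := fun l => emb (some (Sum.inr l))) (fun l => hM (some (Sum.inr l)))
      false
    refine ⟨v', ?_⟩
    rw [add_comm]
    refine .trans (.single ?_) h
    change some (TM2.stepAux (M (emb none)) v S) = _
    simp [hM none, code, hp]
  | @loop_nil k a S hk =>
    intro Λ M emb exit hM v
    refine ⟨false, .single ?_⟩
    change some (TM2.stepAux (M (emb none)) v S) = _
    simp [hM none, code, hk]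
  | @loop_cons k a S S' S'' t t' hk _ _ ih ih' =>
    intro Λ M emb exit hM v
    obtain ⟨v', h⟩ := ih (emb := fun l => emb (some l)) (fun l => hM (some l)) true
    obtain ⟨v'', h'⟩ := ih' hM v'
    refine ⟨v'', .trans (.trans (.single ?_) h) h'⟩
    obtain ⟨s, l, hl⟩ := List.exists_cons_of_ne_nil hk
    change some (TM2.stepAux (M (emb none)) v S) = _
    simp [hM none, code, hl]
  | weaken _ hle ih =>
    intro Λ M emb exit hM v
    obtain ⟨v', s, hs, h⟩ := ih hM v
    exact ⟨v', s, hs.trans hle, h⟩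

/-- The machine which runs a program and then halts. -/
noncomputable def machine [Fintype K] (k₀ k₁ : K) [Fintype (Γ k₀)] (c : Cmd Γ) : FinTM2 :=
  { K := K
    k₀ := k₀
    k₁ := k₁
    Γ := Γ
    Λ := Option (Lab c)
    main := some (Lab.entry c)
    ΛFin := have := finite_lab c; Fintype.ofFinite _
    σ := Bool
    initialState := false
    -- The register is reset before halting because the prescribed final configuration carries the
    -- initial register value; this accounts for one extra step in the time bound.
    m := fun l => l.elim (.load (fun _ => false) .halt) (code c some none) }

theorem dite_eq_update (k₀ : K) (l : List (Γ k₀)) (k : K) :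
    (if h : k = k₀ then (by rw [h]; exact l) else ([] : List (Γ k))) =
      update (fun _ => []) k₀ l k := by
  by_cases hk : k = k₀
  · subst hk
    simp
  · simp [hk]

/-- A program computing a Boolean function within a polynomial time bound gives a decision
procedure. -/
theorem polyTimeDecidable_of_runs [Fintype K] {α Γ₀ : Type} {enc : α → List Γ₀} {P : α → Prop}
    (k₀ k₁ : K) [Fintype (Γ k₀)] (hΓ : ∀ k, Finite (Γ k)) (e₀ : Γ k₀ ≃ Γ₀) (e₁ : Γ k₁ ≃ Bool)
    (c : Cmd Γ) (p : Polynomial ℕ)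
    (h : ∀ a, ∃ b : Bool, (b = true ↔ P a) ∧
      Runs c (update (fun _ => []) k₀ ((enc a).map e₀.symm))
        (update (fun _ => []) k₁ [e₁.symm b]) (p.eval (enc a).length)) :
    PolyTimeDecidable enc P := by
  refine ⟨⟨⟨machine k₀ k₁ c, e₀, e₁⟩, p + 1, fun a => ?_⟩, hΓ⟩
  apply Classical.choice
  obtain ⟨b, hb, hr⟩ := h a
  obtain ⟨v', hv⟩ := hr.reachesIn (M := (machine k₀ k₁ c).m) (emb := some) (exit := none)
    (fun l => rfl) false
  have hd : @decide (P a) (Classical.propDecidable (P a)) = b := by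
    by_cases hP : P a
    · simp [hP, hb.2 hP]
    · have : b = false := by
        cases b
        · rfl
        · exact absurd (hb.1 rfl) hP
      simp [hP, this]
  have h2 : ReachesIn (TM2.step (machine k₀ k₁ c).m)
      ⟨some none, v', update (fun _ => []) k₁ [e₁.symm b]⟩
      ⟨none, false, update (fun _ => []) k₁ [e₁.symm b]⟩ 1 := .single rfl
  obtain ⟨s, hs, hs'⟩ := hv.trans h2
  have hi : initList (machine k₀ k₁ c) ((enc a).map e₀.symm) =
      ⟨some (some (Lab.entry c)), false, update (fun _ => []) k₀ ((enc a).map e₀.symm)⟩ := by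
    refine TM2.Cfg.mk.injEq .. ▸ ⟨rfl, rfl, ?_⟩
    funext k
    exact dite_eq_update _ _ _
  have hh : haltList (machine k₀ k₁ c) [e₁.symm b] =
      ⟨none, false, update (fun _ => []) k₁ [e₁.symm b]⟩ := by
    refine TM2.Cfg.mk.injEq .. ▸ ⟨rfl, rfl, ?_⟩
    funext k
    exact dite_eq_update _ _ _
  refine ⟨⟨⟨s, ?_⟩, by simpa using hs⟩⟩
  rw [hd]
  change (flip bind (TM2.step (machine k₀ k₁ c).m))^[s]
    (some (initList (machine k₀ k₁ c) ((enc a).map e₀.symm))) =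
      some (haltList (machine k₀ k₁ c) [e₁.symm b])
  rw [hi, hh]
  exact hs'

theorem Runs.loop_iterate {k : K} {a : Cmd Γ} {t : ℕ} (m : ℕ) (S : ℕ → ∀ k, List (Γ k))
    (hne : ∀ i < m, S i k ≠ []) (hstep : ∀ i < m, Runs a (S i) (S (i + 1)) t)
    (hend : S m k = []) : Runs (.loop k a) (S 0) (S m) (m * (t + 1) + 1) := by
  induction m generalizing S with
  | zero => simpa using Runs.loop_nil hend
  | succ m ih =>
    refine .weaken (.loop_cons (hne 0 (by omega)) (hstep 0 (by omega))
      (ih (fun i => S (i + 1)) (fun i hi => hne _ (by omega)) (fun i hi => hstep _ (by omega))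
        hend)) ?_
    ring_nf
    omega

end StackProgram

/-! ### Subroutines: scanning, transferring and clearing stacks. -/

namespace StackProgram

open Function Turing StateTransition

section Generic

variable {K : Type} {Γ : K → Type} [DecidableEq K]

theorem Runs.of_eq {c : Cmd Γ} {S S' S'' : ∀ k, List (Γ k)} {t t' : ℕ} (h : Runs c S S' t)
    (he : S'' = S') (ht : t ≤ t') : Runs c S S'' t' := he ▸ h.weaken ht

/-- Moves the `s`-marks of `k` one by one to `k'`, running `body` before each move, and finally
restores `k`. -/
def scan (k k' : K) (s : Γ k) (s' : Γ k') (body : Cmd Γ) : Cmd Γ :=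
  .seq (.loop k (.seq body (.seq (.pop k) (.push k' s')))) (.loop k' (.seq (.pop k') (.push k s)))

/-- The stacks during the `i`-th round of a scan over `m` marks. -/
def scanState (k k' : K) (s : Γ k) (s' : Γ k') (m i : ℕ) (S : ∀ k, List (Γ k)) :
    ∀ k, List (Γ k) :=
  update (update S k (List.replicate (m - i) s)) k' (List.replicate i s')

/-- `A i` records the effect of `i` runs of the body with the two scanned stacks at their resting
contents; `scanState` overlays the current position. The body can read the round number off `k'`.
This is the `for` loop behind every quantifier. The constant `10` is generous. -/
theorem Runs.scan {k k' : K} (hk : k ≠ k') {s : Γ k} {s' : Γ k'} {body : Cmd Γ} {t : ℕ} (m : ℕ)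
    (A : ℕ → ∀ k, List (Γ k)) (h : ∀ i, A i k = List.replicate m s) (h' : ∀ i, A i k' = [])
    (hbody : ∀ i < m, Runs body (scanState k k' s s' m i (A i)) (scanState k k' s s' m i (A (i + 1)))
      t) :
    Runs (scan k k' s s' body) (A 0) (A m) (m * (t + 10) + 2) := by
  have e0 : ∀ j, scanState k k' s s' m 0 (A j) = A j := by
    intro j
    simp only [scanState]
    rw [Nat.sub_zero, ← h j, update_eq_self, List.replicate_zero, ← h' j, update_eq_self]
  have h1 : Runs (.loop k (.seq body (.seq (.pop k) (.push k' s'))))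
      (scanState k k' s s' m 0 (A 0)) (scanState k k' s s' m m (A m)) (m * (t + (1 + 1) + 1) + 1) := by
    refine Runs.loop_iterate m (fun i => scanState k k' s s' m i (A i)) (fun i hi => ?_)
      (fun i hi => .seq (hbody i hi) ?_) ?_
    · simp only [scanState]
      rw [update_of_ne hk, update_self]
      simp only [ne_eq, List.replicate_eq_nil_iff]
      omega
    · refine .of_eq (.seq .pop .push) ?_ le_rfl
      simp only [scanState]
      funext q
      by_cases h1 : q = k'
      · subst h1
        simp [hk.symm, List.replicate_succ]
      · by_cases h2 : q = k
        · subst h2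
          simp [h1, Nat.sub_sub]
        · simp [h1, h2]
    · simp [scanState, hk]
  have h2 : Runs (.loop k' (.seq (.pop k') (.push k s)))
      (scanState k k' s s' m m (A m)) (scanState k k' s s' m 0 (A m)) (m * (1 + 1 + 1) + 1) := by
    have := Runs.loop_iterate (k := k') (a := .seq (.pop k') (.push k s)) (t := 1 + 1) m
      (fun i => scanState k k' s s' m (m - i) (A m)) (fun i hi => ?_) (fun i hi => ?_) ?_
    · simpa using this
    · simp only [scanState, update_self, ne_eq, List.replicate_eq_nil_iff]
      omega
    · refine .of_eq (.seq .pop .push) ?_ le_rfl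
      simp only [scanState]
      funext q
      by_cases h1 : q = k
      · subst h1
        have : m - (m - (i + 1)) = m - (m - i) + 1 := by omega
        simp [hk, this, List.replicate_succ]
      · by_cases h2 : q = k'
        · subst h2
          simp [hk.symm, Nat.sub_sub]
        · simp [h1, h2]
    · simp [scanState]
  rw [e0] at h1 h2
  exact .weaken (.seq h1 h2) (by ring_nf; omega)

/-- A program which does nothing. -/
def skip (k : K) (s : Γ k) : Cmd Γ := .seq (.push k s) (.pop k)

theorem Runs.skip {k : K} {s : Γ k} {S : ∀ k, List (Γ k)} : Runs (skip k s) S S 2 := by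
  exact .of_eq (.seq .push .pop) (by simp) le_rfl

/-- Moves the top of `k` to `k'`, where it becomes `t` or `f` according to the test `p`. -/
def moveTop (k k' : K) (p : Option (Γ k) → Bool) (t f : Γ k') : Cmd Γ :=
  .ite k p (.seq (.pop k) (.push k' t)) (.seq (.pop k) (.push k' f))

theorem Runs.moveTop {k k' : K} (hk : k ≠ k') {p : Option (Γ k) → Bool} {t f : Γ k'}
    {S : ∀ k, List (Γ k)} :
    Runs (moveTop k k' p t f) S
      (update (update S k (S k).tail) k' ((bif p (S k).head? then t else f) :: S k')) 3 := by
  cases h : p (S k).head?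
  · refine .ite_false h ?_
    exact .of_eq (.seq .pop .push) (by simp [hk.symm]) le_rfl
  · refine .ite_true h ?_
    exact .of_eq (.seq .pop .push) (by simp [hk.symm]) le_rfl

/-- One transfer reverses the order; the programs below therefore transfer twice, or collect a list
in reverse first. -/
theorem Runs.moveAll {k k' : K} (hk : k ≠ k') {p : Option (Γ k) → Bool} {t f : Γ k'} :
    ∀ (l : List (Γ k)) (S : ∀ k, List (Γ k)), S k = l →
    Runs (.loop k (StackProgram.moveTop k k' p t f)) S
      (update (update S k [])
        k' ((l.map fun s => bif p (some s) then t else f).reverse ++ S k')) (4 * l.length + 1)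
  | [], S, h => by
    exact .of_eq (.loop_nil h) (by simp [← h]) (by simp)
  | s :: l, S, h => by
    refine .of_eq (.loop_cons (by simp [h]) (.moveTop hk)
      (.moveAll hk l _ (by simp [hk, h]))) ?_ (by simp only [List.length_cons]; omega)
    funext q
    by_cases h1 : q = k'
    · subst h1
      simp_all
    · by_cases h2 : q = k
      · subst h2
        simp [h1]
      · simp [h1, h2]

theorem Runs.clear {k : K} : ∀ (l : List (Γ k)) (S : ∀ k, List (Γ k)), S k = l →
    Runs (.loop k (.pop k)) S (update S k []) (2 * l.length + 1)
  | [], S, h => by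
    exact .of_eq (.loop_nil h) (by simp [← h]) (by simp)
  | s :: l, S, h => by
    have := Runs.loop_cons (by simp [h]) .pop (.clear l (update S k (S k).tail) (by simp [h]))
    rw [update_idem] at this
    exact .weaken this (by simp only [List.length_cons]; omega)

/-- Empties the stacks in a list. -/
def clearAll (k₀ : K) (s : Γ k₀) : List K → Cmd Γ
  | [] => skip k₀ s
  | k :: ks => .seq (.loop k (.pop k)) (clearAll k₀ s ks)

/-- Needed because the final configuration must have every stack except the output empty. -/
theorem Runs.clearAll {k₀ : K} {s : Γ k₀} {N : ℕ} : ∀ (ks : List K) (S : ∀ k, List (Γ k)),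
    (∀ k ∈ ks, (S k).length ≤ N) →
    Runs (clearAll k₀ s ks) S (fun k => if k ∈ ks then [] else S k) (ks.length * (2 * N + 1) + 2)
  | [], S, h => by
    exact .of_eq .skip (by simp) (by simp)
  | k :: ks, S, h => by
    have := Runs.seq (.clear _ S rfl) (.clearAll (s := s) ks (update S k []) (by
      intro q hq
      by_cases hqk : q = k
      · subst hqk
        simp
      · simpa [hqk] using h q (by simp [hq])))
    refine .of_eq this ?_ ?_
    · funext q
      by_cases hqk : q = k
      · subst hqk
        simp
      · simp [hqk]
    · have := h k (by simp)
      simp only [List.length_cons]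
      ring_nf
      omega

end Generic

end StackProgram

/-! ### Counting formulas, tables of relations, and table access. -/

namespace StackProgram

open Function Turing StateTransition

/-- The stacks used to evaluate formulas with variables `ι` over tables `ρ`: the input, a stack of
Boolean results, `n` marks, three scratch stacks, for every variable its value `x` and what remains
of its range `y` and a counter `c`, and the tables. -/
inductive Stk (ι ρ : Type) : Type
  | inp | res | nn | idx | tmp | aux
  | x (v : ι) | y (v : ι) | c (v : ι)
  | tab (r : ρ)
  deriving DecidableEq, Fintype

/-- The alphabets of the stacks. -/
abbrev Sym {ι ρ : Type} : Stk ι ρ → Type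
  | .inp => Option Bool
  | _ => Bool

/-- First-order formulas over finitely many relations on an initial segment of the natural numbers,
with a quantifier `cnt x φ ψ` which says that at most as many `x` satisfy `φ` as satisfy `ψ`. -/
inductive Fml (ι ρ : Type) : Type
  | ff : Fml ι ρ
  | tab (r : ρ) (xs : List ι) : Fml ι ρ
  | le (x y : ι) : Fml ι ρ
  | nand (φ ψ : Fml ι ρ) : Fml ι ρ
  | cnt (x : ι) (φ ψ : Fml ι ρ) : Fml ι ρ

/-- The position of a tuple in the table of a relation, shifted by the position `t` of an initial
segment of the tuple. -/
def tupleIdx (n : ℕ) : ℕ → List ℕ → ℕ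
  | t, [] => t
  | t, i :: l => tupleIdx n (t * n + i) l

/-- The table of a relation of arity `d`. -/
def tabList (n : ℕ) : ℕ → (List ℕ → Bool) → List Bool
  | 0, f => [f []]
  | d + 1, f => (List.range n).flatMap fun i => tabList n d fun l => f (i :: l)

theorem length_tabList (n d : ℕ) (f : List ℕ → Bool) : (tabList n d f).length = n ^ d := by
  induction d generalizing f with
  | zero => rfl
  | succ d ih => simp [tabList, List.length_flatMap, ih, pow_succ']

theorem tupleIdx_eq (n t : ℕ) (l : List ℕ) :
    tupleIdx n t l = t * n ^ l.length + tupleIdx n 0 l := by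
  induction l generalizing t with
  | nil => simp [tupleIdx]
  | cons i l ih =>
    simp only [tupleIdx, List.length_cons]
    rw [ih, ih (0 * n + i)]
    ring

theorem tupleIdx_lt (n : ℕ) (l : List ℕ) (hl : ∀ i ∈ l, i < n) : tupleIdx n 0 l < n ^ l.length := by
  induction l with
  | nil => simp [tupleIdx]
  | cons i l ih =>
    simp only [tupleIdx, List.length_cons]
    rw [tupleIdx_eq]
    have h1 := ih fun j hj => hl j (by simp [hj])
    have h2 : i + 1 ≤ n := hl i (by simp)
    calc (0 * n + i) * n ^ l.length + tupleIdx n 0 l < (i + 1) * n ^ l.length := by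
          rw [Nat.succ_mul, zero_mul, zero_add]; omega
      _ ≤ n * n ^ l.length := Nat.mul_le_mul_right _ h2
      _ = n ^ (l.length + 1) := by ring

theorem getElem?_flatMap_range (n m i j : ℕ) (g : ℕ → List Bool) (hg : ∀ i, (g i).length = m)
    (hi : i < n) (hj : j < m) : ((List.range n).flatMap g)[i * m + j]? = (g i)[j]? := by
  induction n with
  | zero => omega
  | succ n ih =>
    have hl : ((List.range n).flatMap g).length = n * m := by simp [List.length_flatMap, hg]
    rw [List.range_succ, List.flatMap_append]
    rcases Nat.lt_succ_iff_lt_or_eq.1 hi with h | rfl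
    · rw [List.getElem?_append_left, ih h]
      rw [hl]
      calc i * m + j < (i + 1) * m := by rw [add_mul]; omega
        _ ≤ n * m := Nat.mul_le_mul_right _ h
    · rw [List.getElem?_append_right (by omega), hl]
      simp

/-- Tables are in lexicographic order, so a tuple read as a number in base `n` by Horner's rule is
its position. -/
theorem getD_tabList (n : ℕ) (f : List ℕ → Bool) (l : List ℕ) (hl : ∀ i ∈ l, i < n) :
    (tabList n l.length f).getD (tupleIdx n 0 l) false = f l := by
  induction l generalizing f with
  | nil => rfl
  | cons i l ih =>
    have hl' : ∀ j ∈ l, j < n := fun j hj => hl j (by simp [hj])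
    simp only [tupleIdx, List.length_cons, tabList]
    rw [tupleIdx_eq, zero_mul, zero_add, List.getD_eq_getElem?_getD,
      getElem?_flatMap_range n (n ^ l.length) _ _ _ (fun i => length_tabList _ _ _)
        (hl i (by simp)) (tupleIdx_lt n l hl'), ← List.getD_eq_getElem?_getD]
    exact ih _ hl'

/-- Serves only the running time, so entries equal to `n` are allowed, as in `Holds.bound`. -/
theorem tupleIdx_le (n t : ℕ) (l : List ℕ) (hl : ∀ i ∈ l, i ≤ n) :
    tupleIdx n t l ≤ (t + 1) * (n + 1) ^ l.length := by
  induction l generalizing t with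
  | nil => simp [tupleIdx]
  | cons i l ih =>
    have h1 := hl i (by simp)
    refine (ih _ fun j hj => hl j (by simp [hj])).trans ?_
    rw [List.length_cons, pow_succ', ← mul_assoc]
    refine Nat.mul_le_mul_right _ ?_
    ring_nf
    omega

variable {ι ρ : Type} [DecidableEq ι] [DecidableEq ρ]

namespace Fml

/-- The truth value of a formula. -/
def eval (n : ℕ) (L : ρ → List Bool) : Fml ι ρ → (ι → ℕ) → Bool
  | ff, _ => false
  | tab r xs, e => (L r).getD (tupleIdx n 0 (xs.map e)) false
  | le x y, e => decide (e x ≤ e y)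
  | nand φ ψ, e => !(eval n L φ e && eval n L ψ e)
  | cnt x φ ψ, e => decide ((List.range n).countP (fun i => eval n L φ (update e x i)) ≤
      (List.range n).countP (fun i => eval n L ψ (update e x i)))

/-- All free variables are in `B`, and no variable is bound again within its scope. -/
def WF : Fml ι ρ → List ι → Prop
  | ff, _ => True
  | tab _ xs, B => ∀ x ∈ xs, x ∈ B
  | le x y, B => x ∈ B ∧ y ∈ B
  | nand φ ψ, B => WF φ B ∧ WF ψ B
  | cnt x φ ψ, B => x ∉ B ∧ WF φ (x :: B) ∧ WF ψ (x :: B)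

instance decidableWF : ∀ (φ : Fml ι ρ) (B : List ι), Decidable (WF φ B)
  | ff, _ => inferInstanceAs (Decidable True)
  | tab _ xs, B => inferInstanceAs (Decidable (∀ x ∈ xs, x ∈ B))
  | le x y, B => inferInstanceAs (Decidable (x ∈ B ∧ y ∈ B))
  | nand φ ψ, B =>
    have := decidableWF φ B
    have := decidableWF ψ B
    inferInstanceAs (Decidable (WF φ B ∧ WF ψ B))
  | cnt x φ ψ, B =>
    have := decidableWF φ (x :: B)
    have := decidableWF ψ (x :: B)
    inferInstanceAs (Decidable (x ∉ B ∧ WF φ (x :: B) ∧ WF ψ (x :: B)))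

end Fml

/-- The stacks hold the number `n`, the tables `L` and the values `e` of the variables in `B`. -/
structure Holds (n : ℕ) (B : List ι) (e : ι → ℕ) (L : ρ → List Bool)
    (S : ∀ k : Stk ι ρ, List (Sym k)) : Prop where
  nn : S .nn = List.replicate n true
  idx : S .idx = []
  tmp : S .tmp = []
  aux : S .aux = []
  val : ∀ v ∈ B, S (.x v) = List.replicate (e v) true
  bound : ∀ v ∈ B, e v ≤ n
  x : ∀ v ∉ B, S (.x v) = []
  y : ∀ v ∉ B, S (.y v) = List.replicate n true
  c : ∀ v ∉ B, S (.c v) = []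
  tab : ∀ r, S (.tab r) = L r

/-- Adds the number of marks on `k` to the scratch stack `idx`. -/
def addTo (k : Stk ι ρ) (s : Sym k) : Cmd (Sym (ι := ι) (ρ := ρ)) :=
  scan k .aux s true (.push .idx true)

theorem Runs.addTo {k : Stk ι ρ} {s : Sym k} {S : ∀ k : Stk ι ρ, List (Sym k)} (m : ℕ)
    (h1 : k ≠ .aux) (h2 : k ≠ .idx) (hk : S k = List.replicate m s) (ha : S .aux = []) :
    Runs (addTo k s) S (update S .idx (List.replicate m true ++ S .idx)) (m * 11 + 2) := by
  have := Runs.scan (k := k) (k' := Stk.aux) h1 (s := s) (s' := true) (body := .push .idx true)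
    (t := 1) m (fun i => update S .idx (List.replicate i true ++ S .idx))
    (fun i => by simp [h2, hk]) (fun i => by simp [ha]) (fun i hi => by
      refine .of_eq .push ?_ le_rfl
      simp only [scanState]
      funext q
      by_cases hq : q = .idx
      · subst hq
        simp [h2.symm, List.replicate_succ]
      · by_cases hq' : q = k
        · subst hq'
          simp [hq, h1]
        · by_cases ha : q = .aux
          · subst ha
            simp
          · simp [hq, hq', ha])
  simpa [StackProgram.addTo] using this

/-- Whether the top of a stack is the symbol `true`. -/
abbrev isTrue : Option Bool → Bool := fun o => o == some true

theorem map_isTrue (l : List Bool) :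
    (l.map fun s => bif isTrue (some s) then true else false) = l := by
  conv_rhs => rw [← List.map_id l]
  refine List.map_congr_left fun s _ => ?_
  cases s <;> rfl

/-- Multiplies the number of marks on `idx` by `n`. -/
def mulN : Cmd (Sym (ι := ι) (ρ := ρ)) :=
  .seq (.loop .idx (moveTop .idx .tmp isTrue true false))
    (.loop .tmp (.seq (.pop .tmp) (addTo .nn true)))

theorem Runs.mulN {S : ∀ k : Stk ι ρ, List (Sym k)} {n : ℕ} (m : ℕ)
    (hi : S .idx = List.replicate m true) (hn : S .nn = List.replicate n true)
    (ht : S .tmp = []) (ha : S .aux = []) :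
    Runs mulN S (update S .idx (List.replicate (m * n) true)) (m * (11 * n + 8) + 2) := by
  have h1 := Runs.moveAll (k := Stk.idx (ι := ι) (ρ := ρ)) (k' := Stk.tmp) (by simp) (p := isTrue)
    (t := true) (f := false) _ S hi
  rw [map_isTrue, ht] at h1
  let F : ℕ → ∀ k : Stk ι ρ, List (Sym k) := fun i =>
    update (update S .tmp (List.replicate (m - i) true)) .idx (List.replicate (i * n) true)
  have h2 : Runs (.loop .tmp (.seq (.pop .tmp) (StackProgram.addTo .nn true))) (F 0) (F m)
      (m * (1 + (n * 11 + 2) + 1) + 1) := by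
    refine Runs.loop_iterate m F (fun i hi => ?_) (fun i hi => .seq .pop ?_) ?_
    · simp only [F, ne_eq, reduceCtorEq, not_false_eq_true, update_of_ne, update_self,
        List.replicate_eq_nil_iff]
      omega
    · refine .of_eq (.addTo n (by simp) (by simp) ?_ ?_) ?_ le_rfl
      · simp [F, hn]
      · simp [F, ha]
      · funext q
        cases q <;> simp [F, Nat.sub_sub]
        ring
    · simp [F]
  refine .of_eq (.seq (.of_eq h1 ?_ le_rfl) h2) ?_ ?_
  · funext q
    cases q <;> simp [F]
  · funext q
    cases q <;> simp [F, ht]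
  · simp only [List.length_replicate]
    ring_nf
    omega

/-- Computes the position of a tuple of variables on `idx`. -/
def idxCmd : List ι → Cmd (Sym (ι := ι) (ρ := ρ))
  | [] => skip .aux true
  | v :: vs => .seq mulN (.seq (addTo (.x v) true) (idxCmd vs))

/-- Horner's rule. `W` bounds every intermediate value: the hypothesis on `W` passes to the tail
since `t * n + e v + 1 ≤ (t + 1) * (n + 1)`. -/
theorem Runs.idxCmd {n : ℕ} {B : List ι} {e : ι → ℕ} {L : ρ → List Bool}
    {S : ∀ k : Stk ι ρ, List (Sym k)} (hS : Holds n B e L S) (W : ℕ) :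
    ∀ (xs : List ι), (∀ x ∈ xs, x ∈ B) → ∀ t, (t + 1) * (n + 1) ^ xs.length ≤ W →
    Runs (idxCmd xs) (update S .idx (List.replicate t true))
      (update S .idx (List.replicate (tupleIdx n t (xs.map e)) true))
      (xs.length * (W * (11 * n + 8) + 11 * n + 4) + 2)
  | [], _, t, _ => .of_eq .skip rfl (by simp)
  | v :: xs, hx, t, hW => by
    have hv := hS.bound v (hx v (by simp))
    have h1 := Runs.mulN (S := update S .idx (List.replicate t true)) (n := n) t (by simp)
      (by simp [hS.nn]) (by simp [hS.tmp]) (by simp [hS.aux])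
    have h2 := Runs.addTo (k := .x v) (s := true)
      (S := update S .idx (List.replicate (t * n) true)) (e v) (by simp) (by simp)
      (by simpa using hS.val v (hx v (by simp))) (by simp [hS.aux])
    have h3 := Runs.idxCmd hS W xs (fun x h => hx x (by simp [h])) (t * n + e v) (by
      refine le_trans ?_ hW
      rw [List.length_cons, pow_succ', ← mul_assoc]
      refine Nat.mul_le_mul_right _ ?_
      ring_nf
      omega)
    have ht : t ≤ W := by
      refine le_trans ?_ hW
      have : 0 < (n + 1) ^ (v :: xs).length := by positivity
      nlinarith
    rw [update_idem] at h1
    rw [update_idem, update_self, ← List.replicate_add, add_comm (e v)] at h2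
    refine .of_eq (.seq h1 (.seq h2 h3)) rfl ?_
    have := Nat.mul_le_mul_right (11 * n + 8) ht
    rw [List.length_cons, Nat.succ_mul xs.length]
    omega

/-- Reads the entry of the table `r` at the position on `idx`. -/
def lookup (r : ρ) : Cmd (Sym (ι := ι) (ρ := ρ)) :=
  .seq (.loop .idx (.seq (.pop .idx)
      (.ite (.tab r) Option.isSome (moveTop (.tab r) .aux isTrue true false) (skip .aux true))))
    (.seq (.ite (.tab r) isTrue (.push .res true) (.push .res false))
      (.loop .aux (moveTop .aux (.tab r) isTrue true false)))

theorem Runs.lookup {r : ρ} {S : ∀ k : Stk ι ρ, List (Sym k)} {l : List Bool} (m : ℕ)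
    (hi : S .idx = List.replicate m true) (ha : S .aux = []) (hr : S (.tab r) = l) :
    Runs (lookup r) S (update (update S .idx []) .res (l.getD m false :: S .res)) (m * 12 + 4) := by
  -- After `i` rounds the first `i` entries lie reversed on `aux`, so the wanted entry ends up on
  -- top of the table; the final transfer restores the table.
  let F : ℕ → ∀ k : Stk ι ρ, List (Sym k) := fun i =>
    update (update (update S .idx (List.replicate (m - i) true)) (.tab r) (l.drop i)) .aux
      (l.take i).reverse
  have h1 : Runs (.loop .idx (.seq (.pop .idx)
      (.ite (.tab r) Option.isSome (StackProgram.moveTop (.tab r) .aux isTrue true false)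
        (StackProgram.skip .aux true))))
      (F 0) (F m) (m * (1 + 4 + 1) + 1) := by
    refine Runs.loop_iterate m F (fun i hi => ?_) (fun i hi => .seq .pop ?_) ?_
    · simp only [F, ne_eq, reduceCtorEq, not_false_eq_true, update_of_ne, update_self,
        List.replicate_eq_nil_iff]
      omega
    · rcases lt_or_ge i l.length with h | h
      · have hd : l.drop i = l[i] :: l.drop (i + 1) := List.drop_eq_getElem_cons h
        have ht : (l.take (i + 1)).reverse = l[i] :: (l.take i).reverse := by
          rw [← List.take_append_getElem h, List.reverse_append]
          rfl
        have hb : (bif isTrue (some l[i]) then true else false) = l[i] := by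
          cases l[i] <;> rfl
        refine .of_eq (.ite_true ?_ (.moveTop (by simp))) ?_ le_rfl
        · simp [F, h]
        · funext q
          rcases q with _ | _ | _ | _ | _ | _ | v | v | v | r' <;>
            simp only [F, Nat.sub_sub, hd, ht, hb, update_self, update_of_ne, ne_eq, reduceCtorEq,
              not_false_eq_true, List.head?_cons, List.tail_replicate]
          by_cases hr' : r' = r
          · subst hr'
            simp only [update_self, List.tail_cons]
          · simp [hr']
      -- Beyond the end of the table nothing is moved; the empty stack then reads as the default
      -- value `false`.
      · refine .of_eq (.ite_false ?_ .skip) ?_ (by omega)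
        · simp [F, h]
        · funext q
          rcases q with _ | _ | _ | _ | _ | _ | v | v | v | r' <;>
            simp [F, Nat.sub_sub, List.take_of_length_le, List.drop_of_length_le, h,
              Nat.le_succ_of_le h]
          by_cases hr' : r' = r
          · subst hr'
            simp
          · simp [hr']
    · simp [F]
  have h0 : F 0 = S := by
    funext q
    rcases q with _ | _ | _ | _ | _ | _ | v | v | v | r' <;> simp [F, ha, hi]
    by_cases hr' : r' = r
    · subst hr'
      simp [hr]
    · simp [hr']
  rw [h0] at h1
  have h2 : Runs (.ite (.tab r) isTrue (.push .res true) (.push .res false)) (F m)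
      (update (F m) .res (l.getD m false :: S .res)) 2 := by
    cases h : l.getD m false
    · refine .of_eq (.ite_false ?_ .push) (by simp [F]) le_rfl
      simp only [F, ne_eq, reduceCtorEq, not_false_eq_true, update_of_ne, update_self,
        List.head?_drop]
      rw [List.getD_eq_getElem?_getD] at h
      cases h' : l[m]? <;> simp_all
    · refine .of_eq (.ite_true ?_ .push) (by simp [F]) le_rfl
      simp only [F, ne_eq, reduceCtorEq, not_false_eq_true, update_of_ne, update_self,
        List.head?_drop]
      rw [List.getD_eq_getElem?_getD] at h
      cases h' : l[m]? <;> simp_all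
  have h3 := Runs.moveAll (k := Stk.aux (ι := ι) (ρ := ρ)) (k' := Stk.tab r) (by simp)
    (p := isTrue) (t := true) (f := false) (l.take m).reverse
    (update (F m) .res (l.getD m false :: S .res)) (by simp [F])
  rw [map_isTrue] at h3
  refine .of_eq (.seq h1 (.seq h2 h3)) ?_ ?_
  · funext q
    rcases q with _ | _ | _ | _ | _ | _ | v | v | v | r' <;> simp [F, ha]
    by_cases hr' : r' = r
    · subst hr'
      simp [hr]
    · simp [hr']
  · simp only [List.length_reverse, List.length_take]
    have := min_le_left m l.length
    omega

end StackProgram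

/-! ### Evaluation of a fixed formula in polynomial time. -/

namespace StackProgram

open Function Turing StateTransition

variable {ι ρ : Type} [DecidableEq ι] [DecidableEq ρ]

/-- The program evaluating a formula, which pushes the truth value to `res`. -/
def evalCmd : Fml ι ρ → Cmd (Sym (ι := ι) (ρ := ρ))
  | .ff => .push .res false
  | .tab r xs => .seq (idxCmd xs) (lookup r)
  | .le v w => .seq (addTo (.x v) true) (.seq (scan (.x w) .aux true true (.pop .idx))
      (.seq (.ite .idx Option.isSome (.push .res false) (.push .res true)) (.loop .idx (.pop .idx))))
  | .nand φ ψ => .seq (evalCmd φ) (.seq (evalCmd ψ) (.ite .res isTrue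
      (.seq (.pop .res) (.ite .res isTrue (.seq (.pop .res) (.push .res false))
        (.seq (.pop .res) (.push .res true))))
      (.seq (.pop .res) (.seq (.pop .res) (.push .res true)))))
  | .cnt v φ ψ =>
    .seq (scan (.y v) (.x v) true true (.seq (evalCmd φ)
      (.ite .res isTrue (.seq (.pop .res) (.push (.c v) true)) (.pop .res))))
    (.seq (scan (.y v) (.x v) true true (.seq (evalCmd ψ)
      (.ite .res isTrue (.seq (.pop .res) (.pop (.c v))) (.pop .res))))
    (.seq (.ite (.c v) Option.isSome (.push .res false) (.push .res true))
      (.loop (.c v) (.pop (.c v)))))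

/-- A scan over the range of `v`, stopped in round `i`, has exactly `i` marks on `x v`, which is
what binding `v` to `i` means. The counter of `v` and the results are left arbitrary, so the loop
body may change them between rounds. -/
theorem Holds.bind {n : ℕ} {B : List ι} {e : ι → ℕ} {L : ρ → List Bool}
    {S : ∀ k : Stk ι ρ, List (Sym k)} (hS : Holds n B e L S) {v : ι} (hv : v ∉ B) (i : ℕ)
    (hi : i < n) (l : List Bool) (l' : List Bool) :
    Holds n (v :: B) (update e v i) L
      (scanState (.y v) (.x v) true true n i (update (update S (.c v) l) .res l')) where
  nn := by simp [scanState, hS.nn]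
  idx := by simp [scanState, hS.idx]
  tmp := by simp [scanState, hS.tmp]
  aux := by simp [scanState, hS.aux]
  val w hw := by
    by_cases h : w = v
    · subst h
      simp [scanState]
    · have hw : w ∈ B := by simpa [h] using hw
      simp [scanState, h, hS.val w hw]
  bound w hw := by
    by_cases h : w = v
    · subst h
      simpa using hi.le
    · have hw : w ∈ B := by simpa [h] using hw
      simpa [h] using hS.bound w hw
  x w hw := by
    have hw : w ≠ v ∧ w ∉ B := by simpa using hw
    simpa [scanState, hw.1] using hS.x w hw.2
  y w hw := by
    have hw : w ≠ v ∧ w ∉ B := by simpa using hw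
    simpa [scanState, hw.1] using hS.y w hw.2
  c w hw := by
    have hw : w ≠ v ∧ w ∉ B := by simpa using hw
    simpa [scanState, hw.1] using hS.c w hw.2
  tab r := by simpa [scanState] using hS.tab r

theorem Holds.res {n : ℕ} {B : List ι} {e : ι → ℕ} {L : ρ → List Bool}
    {S : ∀ k : Stk ι ρ, List (Sym k)} (hS : Holds n B e L S) (l : List Bool) :
    Holds n B e L (update S .res l) where
  nn := by simp [hS.nn]
  idx := by simp [hS.idx]
  tmp := by simp [hS.tmp]
  aux := by simp [hS.aux]
  val w hw := by simp [hS.val w hw]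
  bound := hS.bound
  x w hw := by simp [hS.x w hw]
  y w hw := by simp [hS.y w hw]
  c w hw := by simp [hS.c w hw]
  tab r := by simp [hS.tab r]

theorem countP_range_succ (p : ℕ → Bool) (i : ℕ) :
    (List.range (i + 1)).countP p = (List.range i).countP p + (bif p i then 1 else 0) := by
  rw [List.range_succ, List.countP_append]
  cases h : p i <;> simp [h]

/-- Popping an empty stack does nothing, so the program computes the truncated difference `e v - e
w`, which vanishes iff `e v ≤ e w`. -/
theorem runs_le {n : ℕ} {B : List ι} {e : ι → ℕ} {L : ρ → List Bool}
    {S : ∀ k : Stk ι ρ, List (Sym k)} (hS : Holds n B e L S) {v w : ι} (hv : v ∈ B) (hw : w ∈ B) :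
    Runs (evalCmd (.le v w)) S (update S .res (decide (e v ≤ e w) :: S .res)) (24 * n + 10) := by
  have hbv := hS.bound v hv
  have hbw := hS.bound w hw
  have h1 := Runs.addTo (k := .x v) (s := true) (S := S) (e v) (by simp) (by simp)
    (by simpa using hS.val v hv) (by simp [hS.aux])
  rw [hS.idx, List.append_nil] at h1
  have h2 := Runs.scan (k := Stk.x w) (k' := Stk.aux (ι := ι) (ρ := ρ)) (by simp) (s := true)
    (s' := true) (body := .pop .idx) (t := 1) (e w)
    (fun i => update S .idx (List.replicate (e v - i) true)) (by simp [hS.val w hw])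
    (by simp [hS.aux]) (fun i _ => by
      refine .of_eq .pop ?_ le_rfl
      simp only [scanState]
      funext q
      rcases q with _ | _ | _ | _ | _ | _ | v' | v' | v' | r' <;> simp [Nat.sub_sub]
      by_cases hv' : v' = w
      · subst hv'
        simp
      · simp [hv'])
  rw [Nat.sub_zero] at h2
  have h3 : Runs (.ite .idx Option.isSome (.push .res false) (.push .res true))
      (update S .idx (List.replicate (e v - e w) true))
      (update (update S .idx (List.replicate (e v - e w) true)) .res
        (decide (e v ≤ e w) :: S .res)) 2 := by
    rcases le_or_gt (e v) (e w) with h | h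
    · refine .of_eq (.ite_false ?_ .push) ?_ le_rfl
      · simp [h]
      · simp [h]
    · obtain ⟨d, hd⟩ := Nat.exists_eq_add_of_lt (Nat.sub_pos_of_lt h)
      refine .of_eq (.ite_true ?_ .push) ?_ le_rfl
      · simp [hd, List.replicate_succ]
      · simp [h.not_ge]
  have h4 := Runs.clear (k := Stk.idx (ι := ι) (ρ := ρ)) _ (update (update S .idx
    (List.replicate (e v - e w) true)) .res (decide (e v ≤ e w) :: S .res)) rfl
  refine .of_eq (.seq h1 (.seq h2 (.seq h3 h4))) ?_ ?_
  · funext q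
    cases q <;> simp [hS.idx]
  · simp
    omega

theorem runs_nand {S : ∀ k : Stk ι ρ, List (Sym k)} (a b : Bool) (l : List Bool) :
    Runs (Cmd.ite .res isTrue
      (.seq (.pop .res) (.ite .res isTrue (.seq (.pop .res) (.push .res false))
        (.seq (.pop .res) (.push .res true))))
      (.seq (.pop .res) (.seq (.pop .res) (.push .res true))))
      (update S .res (b :: a :: l)) (update S .res ((!(a && b)) :: l)) 5 := by
  cases b
  · refine .of_eq (.ite_false (by simp) (.seq .pop (.seq .pop .push))) ?_ (by simp)
    simp
  · cases a
    · refine .of_eq (.ite_true (by simp) (.seq .pop (.ite_false (by simp) (.seq .pop .push)))) ?_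
        (by simp)
      simp
    · refine .of_eq (.ite_true (by simp) (.seq .pop (.ite_true (by simp) (.seq .pop .push)))) ?_
        (by simp)
      simp

/-- The polynomially bounded running time of the evaluation of a formula. -/
theorem runs_evalCmd (φ : Fml ι ρ) : ∃ p : Polynomial ℕ, ∀ (n : ℕ) (B : List ι) (e : ι → ℕ)
    (L : ρ → List Bool) (S : ∀ k : Stk ι ρ, List (Sym k)), φ.WF B → Holds n B e L S →
    Runs (evalCmd φ) S (update S .res (φ.eval n L e :: S .res)) (p.eval n) := by
  induction φ with
  | ff =>
    exact ⟨1, fun n B e L S _ _ => by simpa [evalCmd, Fml.eval] using Runs.push⟩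
  | tab r xs =>
    refine ⟨Polynomial.C xs.length * ((Polynomial.X + 1) ^ xs.length * (11 * Polynomial.X + 8) +
      11 * Polynomial.X + 4) + 2 + ((Polynomial.X + 1) ^ xs.length * 12 + 4),
      fun n B e L S hw hS => ?_⟩
    have h1 := Runs.idxCmd hS ((n + 1) ^ xs.length) xs hw 0 (by simp)
    have h0 : update S .idx (List.replicate 0 true) = S := by
      rw [List.replicate_zero, ← hS.idx, update_eq_self]
    rw [h0] at h1
    have h2 := Runs.lookup (r := r) (S := update S .idx
      (List.replicate (tupleIdx n 0 (xs.map e)) true)) (l := L r) _ (by rw [update_self])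
      (by simp [hS.aux]) (by simp [hS.tab])
    refine .of_eq (.seq h1 h2) ?_ ?_
    · funext q
      cases q <;> simp [hS.idx, Fml.eval]
    · have := tupleIdx_le n 0 (xs.map e) (by simpa using fun x hx => hS.bound x (hw x hx))
      simp only [List.length_map, zero_add, one_mul] at this
      simp
      omega
  | le v w =>
    exact ⟨24 * Polynomial.X + 10, fun n B e L S hw hS => by
      simpa [Fml.eval] using runs_le hS hw.1 hw.2⟩
  | nand φ ψ ihφ ihψ =>
    obtain ⟨p, hp⟩ := ihφ
    obtain ⟨q, hq⟩ := ihψ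
    refine ⟨p + (q + 5), fun n B e L S hw hS => ?_⟩
    have h1 := hp n B e L S hw.1 hS
    have h2 := hq n B e L _ hw.2 (hS.res (φ.eval n L e :: S .res))
    rw [update_idem, update_self] at h2
    exact .of_eq (.seq h1 (.seq h2 (runs_nand _ _ _))) (by simp [Fml.eval]) (by simp)
  | cnt v φ ψ ihφ ihψ =>
    obtain ⟨p, hp⟩ := ihφ
    obtain ⟨q, hq⟩ := ihψ
    refine ⟨Polynomial.X * ((p + 3) + 10) + 2 + (Polynomial.X * ((q + 3) + 10) + 2 +
      (2 + (2 * Polynomial.X + 1))), fun n B e L S hw hS => ?_⟩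
    obtain ⟨hv, hwφ, hwψ⟩ := hw
    set P : ℕ → Bool := fun i => φ.eval n L (update e v i)
    set Q : ℕ → Bool := fun i => ψ.eval n L (update e v i)
    set a := (List.range n).countP P
    set b := (List.range n).countP Q
    have hle : a ≤ n := by simpa using List.countP_le_length (p := P) (l := List.range n)
    have h1 := Runs.scan (k := Stk.y v) (k' := Stk.x (ι := ι) (ρ := ρ) v) (by simp) (s := true)
      (s' := true) (body := .seq (evalCmd φ)
        (.ite .res isTrue (.seq (.pop .res) (.push (.c v) true)) (.pop .res)))
      (t := p.eval n + 3) n (fun i => update S (.c v) (List.replicate ((List.range i).countP P) true))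
      (by simp [hS.y v hv]) (by simp [hS.x v hv]) (fun i hi => by
        have hb := hp n _ _ L _ hwφ
          (hS.bind hv i hi (List.replicate ((List.range i).countP P) true) (S .res))
        have he : update (update S (.c v) (List.replicate ((List.range i).countP P) true)) .res
            (S .res) = update S (.c v) (List.replicate ((List.range i).countP P) true) := by
          rw [update_eq_iff]
          simp
        rw [he] at hb
        refine .seq hb ?_
        cases hc : P i
        · refine .of_eq (.ite_false (by simp [P] at hc; simp [hc]) .pop) ?_ (by simp)
          rw [countP_range_succ, hc]
          funext q
          cases q <;> simp [scanState]
        · refine .of_eq (.ite_true (by simp [P] at hc; simp [hc]) (.seq .pop .push)) ?_ (by simp)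
          rw [countP_range_succ, hc]
          funext q
          rcases q with _ | _ | _ | _ | _ | _ | v' | v' | v' | r' <;> simp [scanState]
          all_goals
            by_cases hv' : v' = v
            · subst hv'
              simp [List.replicate_succ]
            · simp [hv'])
    -- The second scan takes one mark off the counter for each witness of `ψ`. By truncated
    -- subtraction the counter ends empty iff `a ≤ b`.
    have h2 := Runs.scan (k := Stk.y v) (k' := Stk.x (ι := ι) (ρ := ρ) v) (by simp) (s := true)
      (s' := true) (body := .seq (evalCmd ψ)
        (.ite .res isTrue (.seq (.pop .res) (.pop (.c v))) (.pop .res)))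
      (t := q.eval n + 3) n
      (fun i => update S (.c v) (List.replicate (a - (List.range i).countP Q) true))
      (by simp [hS.y v hv]) (by simp [hS.x v hv]) (fun i hi => by
        have hb := hq n _ _ L _ hwψ
          (hS.bind hv i hi (List.replicate (a - (List.range i).countP Q) true) (S .res))
        have he : update (update S (.c v) (List.replicate (a - (List.range i).countP Q) true)) .res
            (S .res) = update S (.c v) (List.replicate (a - (List.range i).countP Q) true) := by
          rw [update_eq_iff]
          simp
        rw [he] at hb
        refine .seq hb ?_
        cases hc : Q i
        · refine .of_eq (.ite_false (by simp [Q] at hc; simp [hc]) .pop) ?_ (by simp)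
          rw [countP_range_succ, hc]
          funext q
          cases q <;> simp [scanState]
        · refine .of_eq (.ite_true (by simp [Q] at hc; simp [hc]) (.seq .pop .pop)) ?_ (by simp)
          rw [countP_range_succ, hc]
          funext q
          rcases q with _ | _ | _ | _ | _ | _ | v' | v' | v' | r' <;> simp [scanState]
          all_goals
            by_cases hv' : v' = v
            · subst hv'
              simp [Nat.sub_sub]
            · simp [hv'])
    have h0 : update S (.c v) (List.replicate ((List.range 0).countP P) true) = S := by
      rw [update_eq_iff]
      simp [hS.c v hv]
    rw [h0] at h1
    rw [List.range_zero, List.countP_nil, Nat.sub_zero] at h2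
    have h3 : Runs (.ite (.c v) Option.isSome (.push .res false) (.push .res true))
        (update S (.c v) (List.replicate (a - b) true))
        (update (update S (.c v) (List.replicate (a - b) true)) .res
          (decide (a ≤ b) :: S .res)) 2 := by
      rcases le_or_gt a b with h | h
      · refine .of_eq (.ite_false ?_ .push) ?_ le_rfl
        · simp [h]
        · simp [h]
      · obtain ⟨d, hd⟩ := Nat.exists_eq_add_of_lt (Nat.sub_pos_of_lt h)
        refine .of_eq (.ite_true ?_ .push) ?_ le_rfl
        · simp [hd, List.replicate_succ]
        · simp [h.not_ge]
    have h4 := Runs.clear (k := Stk.c (ι := ι) (ρ := ρ) v) _ (update (update S (.c v)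
      (List.replicate (a - b) true)) .res (decide (a ≤ b) :: S .res)) rfl
    refine .of_eq (.seq h1 (.seq h2 (.seq h3 h4))) ?_ ?_
    · funext q
      rcases q with _ | _ | _ | _ | _ | _ | v' | v' | v' | r' <;> simp [Fml.eval, P, Q, a, b]
      by_cases hv' : v' = v
      · subst hv'
        simp [hS.c _ hv]
      · simp [hv']
    · simp
      omega

end StackProgram

/-! ### Iterated definitions of relations. -/

namespace StackProgram

open Function Turing StateTransition

variable {ι ρ : Type} [DecidableEq ι] [DecidableEq ρ]

/-- Binds the variables of a list to the entries of a tuple. -/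
def bindTuple (e : ι → ℕ) : List ι → List ℕ → ι → ℕ
  | z :: zs, i :: is => bindTuple (update e z i) zs is
  | _, _ => e

/-- Evaluates a formula for all values of the variables in a list, in lexicographic order. -/
def forAllCmd (φ : Fml ι ρ) : List ι → Cmd (Sym (ι := ι) (ρ := ρ))
  | [] => evalCmd φ
  | z :: zs => scan (.y z) (.x z) true true (forAllCmd φ zs)

/-- Well-formedness of a formula with additional variables bound in the order of a list. -/
def WFAll (φ : Fml ι ρ) : List ι → List ι → Prop
  | [], B => φ.WF B
  | z :: zs, B => z ∉ B ∧ WFAll φ zs (z :: B)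

instance decidableWFAll (φ : Fml ι ρ) : ∀ zs B : List ι, Decidable (WFAll φ zs B)
  | [], B => inferInstanceAs (Decidable (φ.WF B))
  | z :: zs, B =>
    have := decidableWFAll φ zs (z :: B)
    inferInstanceAs (Decidable (z ∉ B ∧ WFAll φ zs (z :: B)))

/-- One nested loop per variable multiplies the time by about `n`. The truth values are pushed in
lexicographic order and hence lie reversed on `res`; the old table stays readable until all of them
are computed. -/
theorem runs_forAllCmd (φ : Fml ι ρ) (zs : List ι) : ∃ p : Polynomial ℕ, ∀ (n : ℕ) (B : List ι)
    (e : ι → ℕ) (L : ρ → List Bool) (S : ∀ k : Stk ι ρ, List (Sym k)), WFAll φ zs B →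
    Holds n B e L S → Runs (forAllCmd φ zs) S (update S .res
      ((tabList n zs.length fun is => φ.eval n L (bindTuple e zs is)).reverse ++ S .res))
      (p.eval n) := by
  induction zs with
  | nil =>
    obtain ⟨p, hp⟩ := runs_evalCmd φ
    exact ⟨p, fun n B e L S hw hS => by simpa [tabList, bindTuple, forAllCmd] using hp n B e L S hw hS⟩
  | cons z zs ih =>
    obtain ⟨p, hp⟩ := ih
    refine ⟨Polynomial.X * (p + 10) + 2, fun n B e L S hw hS => ?_⟩
    obtain ⟨hz, hw⟩ := hw
    let g : ℕ → List Bool := fun i =>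
      tabList n zs.length fun is => φ.eval n L (bindTuple (update e z i) zs is)
    have h := Runs.scan (k := Stk.y z) (k' := Stk.x (ι := ι) (ρ := ρ) z) (by simp) (s := true)
      (s' := true) (body := forAllCmd φ zs) (t := p.eval n) n
      (fun i => update S .res (((List.range i).flatMap g).reverse ++ S .res))
      (by simp [hS.y z hz]) (by simp [hS.x z hz]) (fun i hi => by
        have hb := hp n _ _ L _ hw
          (hS.bind hz i hi [] (((List.range i).flatMap g).reverse ++ S .res))
        have he : update S (.c z) [] = S := by
          rw [update_eq_iff]
          simp [hS.c z hz]
        rw [he] at hb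
        refine .of_eq hb ?_ le_rfl
        simp only [List.range_succ, List.flatMap_append, List.reverse_append]
        funext q
        rcases q with _ | _ | _ | _ | _ | _ | v | v | v | r <;> simp [scanState, g]
        all_goals
          by_cases hv : v = z
          · subst hv
            simp
          · simp [hv])
    have h0 : update S .res (((List.range 0).flatMap g).reverse ++ S .res) = S := by
      rw [update_eq_iff]
      simp
    rw [h0] at h
    exact .of_eq h rfl (by simp)

/-- Replaces the table `r` by the relation defined by `φ` in the variables `zs`. -/
structure Rule (ι ρ : Type) : Type where
  r : ρ
  zs : List ι
  φ : Fml ι ρ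

/-- The standard contents of the stacks: the number `n` and tables `L`. -/
def tabState (n : ℕ) (L : ρ → List Bool) : ∀ k : Stk ι ρ, List (Sym k)
  | .nn => List.replicate n true
  | .y _ => List.replicate n true
  | .tab r => L r
  | .inp => []
  | .res => []
  | .idx => []
  | .tmp => []
  | .aux => []
  | .x _ => []
  | .c _ => []

theorem update_tabState (n : ℕ) (L : ρ → List Bool) (r : ρ) (l : List Bool) :
    update (tabState (ι := ι) n L) (.tab r) l = tabState n (update L r l) := by
  funext q
  rcases q with _ | _ | _ | _ | _ | _ | v | v | v | r' <;> simp [tabState]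
  by_cases hr' : r' = r
  · subst hr'
    simp
  · simp [hr', tabState]

theorem holds_tabState (n : ℕ) (e : ι → ℕ) (L : ρ → List Bool) :
    Holds n [] e L (tabState n L) := by
  constructor <;> simp [tabState]

/-- The tables after `i` applications of a rule, with `v` bound to the number of the round. -/
def stage (n : ℕ) (v : ι) (R : Rule ι ρ) (L : ρ → List Bool) : ℕ → ρ → List Bool
  | 0 => L
  | i + 1 => update (stage n v R L i) R.r (tabList n R.zs.length fun is =>
      R.φ.eval n (stage n v R L i) (bindTuple (update (fun _ => 0) v i) R.zs is))

/-- The program applying a rule `n` times. -/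
def ruleCmd (v : ι) (R : Rule ι ρ) : Cmd (Sym (ι := ι) (ρ := ρ)) :=
  scan (.y v) (.x v) true true (.seq (forAllCmd R.φ R.zs)
    (.seq (.loop (.tab R.r) (.pop (.tab R.r)))
      (.loop .res (moveTop .res (.tab R.r) isTrue true false))))

/-- A bound on all tables that is uniform in the round, since clearing the old table costs time
proportional to its length. The base is `n + 1` so that exponents can be raised even for `n = 0`. -/
theorem length_stage_le {n m : ℕ} {v : ι} {R : Rule ι ρ} {L : ρ → List Bool}
    (hm : R.zs.length ≤ m) (hL : ∀ r, (L r).length ≤ (n + 1) ^ m) (i : ℕ) (r : ρ) :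
    (stage n v R L i r).length ≤ (n + 1) ^ m := by
  induction i with
  | zero => exact hL r
  | succ i ih =>
    by_cases hr : r = R.r
    · subst hr
      simp only [stage, update_self, length_tabList]
      calc n ^ R.zs.length ≤ (n + 1) ^ R.zs.length := Nat.pow_le_pow_left (by omega) _
        _ ≤ (n + 1) ^ m := Nat.pow_le_pow_right (by omega) hm
    · simpa [stage, hr] using ih

theorem runs_ruleCmd (v : ι) (R : Rule ι ρ) (hw : WFAll R.φ R.zs [v]) (m : ℕ)
    (hm : R.zs.length ≤ m) : ∃ p : Polynomial ℕ, ∀ (n : ℕ) (L : ρ → List Bool),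
    (∀ r, (L r).length ≤ (n + 1) ^ m) →
    Runs (ruleCmd v R) (tabState n L) (tabState n (stage n v R L n)) (p.eval n) := by
  obtain ⟨p, hp⟩ := runs_forAllCmd R.φ R.zs
  refine ⟨Polynomial.X * ((p + (2 * (Polynomial.X + 1) ^ m + 1 +
    (4 * (Polynomial.X + 1) ^ m + 1))) + 10) + 2, fun n L hL => ?_⟩
  have hscan := Runs.scan (k := Stk.y v) (k' := Stk.x (ι := ι) (ρ := ρ) v) (by simp) (s := true)
      (s' := true) (t := p.eval n + (2 * (n + 1) ^ m + 1 + (4 * (n + 1) ^ m + 1)))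
      (body := .seq (forAllCmd R.φ R.zs) (.seq (.loop (.tab R.r) (.pop (.tab R.r)))
        (.loop .res (StackProgram.moveTop .res (.tab R.r) isTrue true false)))) n
      (fun i => tabState n (stage n v R L i)) (by simp [tabState]) (by simp [tabState])
  refine .of_eq (hscan fun i hi => ?_) rfl (by simp [add_assoc])
  have hb := hp n _ _ _ _ hw ((holds_tabState n (fun _ => 0) (stage n v R L i)).bind
    (v := v) (by simp) i hi [] [])
  have he : update (update (tabState (ι := ι) n (stage n v R L i)) (.c v) []) .res [] =
      tabState n (stage n v R L i) := by
    funext q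
    rcases q with _ | _ | _ | _ | _ | _ | v' | v' | v' | r' <;> simp [tabState]
    by_cases hv' : v' = v
    · subst hv'
      simp
    · simp [hv', tabState]
  rw [he] at hb
  set T := tabList n R.zs.length fun is =>
    R.φ.eval n (stage n v R L i) (bindTuple (update (fun _ => 0) v i) R.zs is) with hT
  have hlT : T.length ≤ (n + 1) ^ m := by
    rw [hT, length_tabList]
    calc n ^ R.zs.length ≤ (n + 1) ^ R.zs.length := Nat.pow_le_pow_left (by omega) _
      _ ≤ (n + 1) ^ m := Nat.pow_le_pow_right (by omega) hm
  have hlS := length_stage_le hm hL (v := v) i R.r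
  set S := scanState (.y v) (.x v) true true n i (tabState (ι := ι) n (stage n v R L i)) with hS
  have hres : S .res = [] := by simp [hS, scanState, tabState]
  have htab : S (.tab R.r) = stage n v R L i R.r := by simp [hS, scanState, tabState]
  rw [hres, List.append_nil] at hb
  have h2 := Runs.clear (k := Stk.tab (ι := ι) R.r) _ (update S .res T.reverse) rfl
  have h3 := Runs.moveAll (k := Stk.res (ι := ι) (ρ := ρ)) (k' := .tab R.r) (by simp)
    (p := isTrue) (t := true) (f := false) T.reverse
    (update (update S .res T.reverse) (.tab R.r) []) (by simp)
  rw [map_isTrue] at h3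
  refine .of_eq (.seq hb (.seq h2 h3)) ?_ ?_
  · have : stage n v R L (i + 1) = update (stage n v R L i) R.r T := rfl
    rw [this, ← update_tabState]
    funext q
    rcases q with _ | _ | _ | _ | _ | _ | v' | v' | v' | r' <;> simp [hS, scanState, tabState]
    · by_cases hv' : v' = v
      · subst hv'
        simp
      · simp [hv']
    · by_cases hv' : v' = v
      · subst hv'
        simp
      · simp [hv']
    · by_cases hr' : r' = R.r
      · subst hr'
        simp
      · simp [hr', tabState]
  · simp [htab]
    omega

/-- The tables after applying each of several rules `n` times. -/
def applyRules (n : ℕ) (v : ι) : List (Rule ι ρ) → (ρ → List Bool) → ρ → List Bool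
  | [], L => L
  | R :: Rs, L => applyRules n v Rs (stage n v R L n)

/-- The program applying each of several rules `n` times. -/
def rulesCmd (v : ι) : List (Rule ι ρ) → Cmd (Sym (ι := ι) (ρ := ρ))
  | [] => skip .aux true
  | R :: Rs => .seq (ruleCmd v R) (rulesCmd v Rs)

theorem runs_rulesCmd (v : ι) (m : ℕ) (Rs : List (Rule ι ρ)) (hw : ∀ R ∈ Rs, WFAll R.φ R.zs [v])
    (hm : ∀ R ∈ Rs, R.zs.length ≤ m) : ∃ p : Polynomial ℕ, ∀ (n : ℕ) (L : ρ → List Bool),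
    (∀ r, (L r).length ≤ (n + 1) ^ m) → (∀ r, (applyRules n v Rs L r).length ≤ (n + 1) ^ m) ∧
    Runs (rulesCmd v Rs) (tabState n L) (tabState n (applyRules n v Rs L)) (p.eval n) := by
  induction Rs with
  | nil => exact ⟨2, fun n L hL => ⟨hL, by simpa [rulesCmd, applyRules] using Runs.skip⟩⟩
  | cons R Rs ih =>
    obtain ⟨p, hp⟩ := runs_ruleCmd v R (hw R (by simp)) m (hm R (by simp))
    obtain ⟨q, hq⟩ := ih (fun R h => hw R (by simp [h])) (fun R h => hm R (by simp [h]))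
    refine ⟨p + q, fun n L hL => ?_⟩
    obtain ⟨h1, h2⟩ := hq n _ (length_stage_le (hm R (by simp)) hL (v := v) n)
    exact ⟨h1, .of_eq (.seq (hp n L hL) h2) rfl (by simp)⟩

end StackProgram

/-! ### Reading the adjacency matrix; definable properties are polynomial-time decidable. -/

namespace StackProgram

open Function Turing StateTransition

variable {ι ρ : Type} [DecidableEq ι] [DecidableEq ρ]

/-- Pushes one mark on the range of each variable in a list. -/
def pushAll : List ι → Cmd (Sym (ι := ι) (ρ := ρ))
  | [] => skip .aux true
  | v :: vs => .seq (.push (.y v) true) (pushAll vs)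

/-- The stacks while the input is read: the rest of the input, the entries read so far, and the
number of rows read so far, already increased by one for the variables in `vs`. -/
def readState (l : List (Option Bool)) (acc : List Bool) (m : ℕ) (m' : ι → ℕ) :
    ∀ k : Stk ι ρ, List (Sym k)
  | .inp => l
  | .res => acc
  | .nn => List.replicate m true
  | .y v => List.replicate (m' v) true
  | .idx => []
  | .tmp => []
  | .aux => []
  | .x _ => []
  | .c _ => []
  | .tab _ => []

theorem runs_pushAll (l : List (Option Bool)) (acc : List Bool) (m : ℕ) :
    ∀ (vs : List ι) (m' : ι → ℕ), Runs (pushAll vs) (readState (ρ := ρ) l acc m m')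
      (readState l acc m (fun v => m' v + vs.count v)) (vs.length + 2)
  | [], m' => .of_eq .skip rfl (by simp)
  | w :: vs, m' => by
    have h : update (readState (ρ := ρ) l acc m m') (.y w) (true :: readState l acc m m' (.y w)) =
        readState l acc m (update m' w (m' w + 1)) := by
      funext q
      rcases q with _ | _ | _ | _ | _ | _ | v | v | v | r <;> simp [readState]
      by_cases hv : v = w
      · subst hv
        simp [List.replicate_succ]
      · simp [hv, readState]
    refine .of_eq (.seq (.of_eq .push h.symm le_rfl) (runs_pushAll l acc m vs _)) ?_ (by
      simp only [List.length_cons]; omega)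
    congr 1
    funext v
    by_cases hv : v = w
    · subst hv
      simp
      omega
    · simp [hv, Ne.symm hv]

/-- Reads the adjacency matrix into the table `adj`. -/
def readCmd (adj : ρ) (vs : List ι) : Cmd (Sym (ι := ι) (ρ := ρ)) :=
  .seq (.loop .inp (.ite .inp (fun o => o == some none)
      (.seq (.pop .inp) (.seq (.push .nn true) (pushAll vs)))
      (moveTop .inp .res (fun o => o == some (some true)) true false)))
    (.loop .res (moveTop .res (.tab adj) isTrue true false))

/-- The row markers count the vertices: each puts one mark on `nn` and on the range of every
variable. The list `vs` must contain each variable exactly once for all ranges to have the same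
size. -/
theorem runs_readLoop (vs : List ι) (hvs : ∀ v, vs.count v = 1) :
    ∀ (l : List (Option Bool)) (acc : List Bool) (m : ℕ),
    Runs (.loop .inp (.ite .inp (fun o => o == some none)
      (.seq (.pop .inp) (.seq (.push .nn true) (pushAll vs)))
      (moveTop .inp .res (fun o => o == some (some true)) true false)))
      (readState (ρ := ρ) l acc m fun _ => m)
      (readState [] (l.reduceOption.reverse ++ acc) (m + l.count none) fun _ => m + l.count none)
      (l.length * (vs.length + 6) + 1)
  | [], acc, m => .of_eq (.loop_nil rfl) (by simp) (by simp)
  | none :: l, acc, m => by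
    have h1 : update (update (readState (ι := ι) (ρ := ρ) (none :: l) acc m fun _ => m) .inp
        (readState (ι := ι) (ρ := ρ) (none :: l) acc m (fun _ => m) .inp).tail) .nn (true ::
          update (readState (ι := ι) (ρ := ρ) (none :: l) acc m fun _ => m) .inp
        (readState (ι := ι) (ρ := ρ) (none :: l) acc m (fun _ => m) .inp).tail .nn) =
        readState l acc (m + 1) fun _ => m := by
      funext q
      cases q <;> simp [readState, List.replicate_succ]
    have h2 := runs_pushAll (ρ := ρ) l acc (m + 1) vs (fun _ => m)
    simp only [hvs] at h2
    refine .of_eq (.loop_cons (by simp [readState]) (.ite_true (by simp [readState])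
      (.seq .pop (.seq (.of_eq .push h1.symm le_rfl) h2)))
      (runs_readLoop vs hvs l acc (m + 1))) ?_ ?_
    · simp only [List.count_cons, List.reduceOption_cons_of_none]
      simp [add_assoc, add_comm]
    · simp only [List.length_cons]
      ring_nf
      omega
  | some b :: l, acc, m => by
    have hk : (Stk.inp : Stk ι ρ) ≠ .res := by simp
    refine .of_eq (.loop_cons (by simp [readState]) (.ite_false (by simp [readState])
      (.of_eq (.moveTop hk) (S'' := readState l (b :: acc) m fun _ => m) ?_ le_rfl))
      (runs_readLoop vs hvs l (b :: acc) m)) ?_ ?_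
    · funext q
      cases b <;> cases q <;> simp [readState]
    · simp
    · simp only [List.length_cons]
      ring_nf
      omega

theorem runs_readCmd (adj : ρ) (vs : List ι) (hvs : ∀ v, vs.count v = 1)
    (l : List (Option Bool)) :
    Runs (readCmd adj vs) (update (fun _ => []) .inp l)
      (tabState (l.count none) (update (fun _ => []) adj l.reduceOption))
      (l.length * (vs.length + 10) + 2) := by
  have h1 := runs_readLoop (ρ := ρ) vs hvs l [] 0
  have h0 : readState l [] 0 (fun _ => 0) =
      (update (fun _ => []) .inp l : ∀ k : Stk ι ρ, List (Sym k)) := by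
    funext q
    cases q <;> simp [readState]
  rw [h0] at h1
  have hk : (Stk.res : Stk ι ρ) ≠ .tab adj := by simp
  have h2 := Runs.moveAll hk (p := isTrue) (t := true) (f := false) _
    (readState [] (l.reduceOption.reverse ++ []) (0 + l.count none) fun _ => 0 + l.count none) rfl
  rw [map_isTrue] at h2
  refine .of_eq (.seq h1 h2) ?_ ?_
  · funext q
    rcases q with _ | _ | _ | _ | _ | _ | v | v | v | r <;> simp [readState, tabState]
    by_cases hr : r = adj
    · subst hr
      simp
    · simp [hr, readState]
  · have := List.reduceOption_length_le l
    simp [readState]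
    ring_nf
    omega

open scoped Classical in
/-- The adjacency relation of an input graph as a relation on numbers. -/
noncomputable def adjRel (G : InputGraph) : List ℕ → Bool
  | [i, j] => decide (∃ (hi : i < G.1) (hj : j < G.1), G.2.Adj ⟨i, hi⟩ ⟨j, hj⟩)
  | _ => false

theorem flatMap_finRange {α : Type} (n : ℕ) (g : ℕ → List α) :
    (List.finRange n).flatMap (fun i : Fin n => g i.val) = (List.range n).flatMap g := by
  have : List.range n = (List.finRange n).map Fin.val := by
    refine List.ext_getElem (by simp) fun i _ _ => by simp
  rw [this, List.flatMap_map]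

theorem reduceOption_encodeGraph (G : InputGraph) :
    (encodeGraph G).reduceOption = tabList G.1 2 (adjRel G) := by
  classical
  have h : ∀ i : Fin G.1, ((List.finRange G.1).map (fun j => some (decide (G.2.Adj i j))) ++
      [none]).reduceOption = tabList G.1 1 fun l => adjRel G (i :: l) := by
    intro i
    rw [List.reduceOption_append]
    simp only [tabList]
    rw [← flatMap_finRange, ← List.map_eq_flatMap]
    simp only [adjRel, Fin.is_lt, exists_true_left]
    simp [List.reduceOption, List.filterMap_map]
  rw [tabList, ← flatMap_finRange, encodeGraph]
  unfold List.reduceOption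
  rw [List.filterMap_flatMap]
  refine List.flatMap_congr fun i _ => ?_
  rw [← h i]
  rfl

theorem count_none_encodeGraph (G : InputGraph) : (encodeGraph G).count none = G.1 := by
  classical
  rw [encodeGraph, List.count_flatMap]
  have : (List.count none ∘ fun i => (List.finRange G.1).map (fun j =>
      some (decide (G.2.Adj i j))) ++ [none]) = fun _ => 1 := by
    funext i
    simp [List.count_eq_zero]
  rw [this]
  simp

theorem length_encodeGraph (G : InputGraph) : (encodeGraph G).length = G.1 * (G.1 + 1) := by
  simp [encodeGraph, List.length_flatMap]

theorem eval_mono (p : Polynomial ℕ) {a b : ℕ} (h : a ≤ b) : p.eval a ≤ p.eval b := by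
  rw [Polynomial.eval_eq_sum, Polynomial.eval_eq_sum]
  exact Finset.sum_le_sum fun i _ => Nat.mul_le_mul_left _ (Nat.pow_le_pow_left h i)

/-- A graph property defined by a formula over relations which are themselves obtained from the
adjacency relation by iterating first-order definitions is decidable in polynomial time. -/
theorem polyTimeDecidable_of_rules [Fintype ι] [Fintype ρ] (adj : ρ) (v : ι)
    (Rs : List (Rule ι ρ)) (ψ : Fml ι ρ) (hR : ∀ R ∈ Rs, WFAll R.φ R.zs [v]) (hψ : ψ.WF [])
    (P : InputGraph → Prop)
    (h : ∀ G : InputGraph, ψ.eval G.1 (applyRules G.1 v Rs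
      (update (fun _ => []) adj (tabList G.1 2 (adjRel G)))) (fun _ => 0) = true ↔ P G) :
    PolyTimeDecidable encodeGraph P := by
  obtain ⟨m, hm2, hm⟩ : ∃ m, 2 ≤ m ∧ ∀ R ∈ Rs, R.zs.length ≤ m := by
    -- A crude common bound for the arities of all rules and of the binary input table.
    refine ⟨2 + (Rs.map fun R => R.zs.length).sum, by omega, fun R hR => ?_⟩
    have := List.single_le_sum (l := Rs.map fun R => R.zs.length) (by simp) _
      (List.mem_map_of_mem hR)
    omega
  obtain ⟨p, hp⟩ := runs_rulesCmd v m Rs hR hm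
  obtain ⟨q, hq⟩ := runs_evalCmd ψ
  let vs : List ι := (Finset.univ : Finset ι).toList
  have hvs : ∀ v, vs.count v = 1 := fun v =>
    List.count_eq_one_of_mem (Finset.nodup_toList _) (by simp [vs])
  let ks : List (Stk ι ρ) := (Finset.univ.erase .res).toList
  refine polyTimeDecidable_of_runs (K := Stk ι ρ) (Γ := Sym) .inp .res (by
      intro k; cases k <;> simp only [Sym] <;> infer_instance) (Equiv.refl _) (Equiv.refl _)
    (.seq (readCmd adj vs) (.seq (rulesCmd v Rs) (.seq (evalCmd ψ) (clearAll .aux true ks))))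
    (Polynomial.X * Polynomial.C (vs.length + 10) + 2 + (p + (q +
      (Polynomial.C ks.length * (2 * (Polynomial.X + 1) ^ m + 1) + 2))))
    (fun G => ⟨_, h G, ?_⟩)
  have hl := length_encodeGraph G
  set n := G.1 with hn
  set L₀ : ρ → List Bool := update (fun _ => []) adj (tabList n 2 (adjRel G)) with hL₀
  have h1 := runs_readCmd adj vs hvs (encodeGraph G)
  rw [count_none_encodeGraph, reduceOption_encodeGraph] at h1
  have hlen : ∀ r, (L₀ r).length ≤ (n + 1) ^ m := by
    intro r
    by_cases hr : r = adj
    · subst hr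
      rw [hL₀, update_self, length_tabList]
      calc n ^ 2 ≤ (n + 1) ^ 2 := Nat.pow_le_pow_left (by omega) _
        _ ≤ (n + 1) ^ m := Nat.pow_le_pow_right (by omega) hm2
    · simp [hL₀, hr]
  obtain ⟨hlen', h2⟩ := hp n L₀ hlen
  set L := applyRules n v Rs L₀
  have h3 := hq n [] (fun _ => 0) L _ hψ (holds_tabState n _ L)
  have hn1 : n ≤ (n + 1) ^ m := calc
    n ≤ (n + 1) ^ 1 := by rw [pow_one]; exact Nat.le_succ n
    _ ≤ (n + 1) ^ m := Nat.pow_le_pow_right (by omega) (by omega)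
  have h4 := Runs.clearAll (k₀ := Stk.aux) (s := true) (N := (n + 1) ^ m) ks
    (update (tabState (ι := ι) n L) .res [ψ.eval n L fun _ => 0]) (by
      intro k hk
      rcases k with _ | _ | _ | _ | _ | _ | w | w | w | r <;> simp [tabState, hn1, hlen']
      simp [ks] at hk)
  -- The subprograms are bounded by polynomials in `n`, the machine by one in the input length;
  -- monotonicity passes from one to the other.
  have hle : n ≤ (encodeGraph G).length := by
    rw [hl]
    nlinarith
  have he : (encodeGraph G).map (Equiv.refl (Option Bool)).symm = encodeGraph G := by simp
  rw [he]
  refine .of_eq (.seq h1 (.seq h2 (.seq h3 h4))) ?_ ?_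
  · funext q
    cases q <;> simp [ks, L, L₀]
  · have h5 := eval_mono p hle
    have h6 := eval_mono q hle
    have h7 := Nat.pow_le_pow_left (Nat.succ_le_succ hle) m
    have h8 := Nat.mul_le_mul_left ks.length (Nat.succ_le_succ (Nat.mul_le_mul_left 2 h7))
    simp at h8 ⊢
    omega

end StackProgram

/-! ### Components, co-components and isomorphism of cographs. -/

namespace Cograph

variable {α : Type*} {K : α → α → Prop}

/-- No induced path on four vertices, for a symmetric and irreflexive relation. -/
def P4Free (K : α → α → Prop) : Prop :=
  ∀ p q r s, K p q → K q r → K r s → ¬ K p r → ¬ K p s → ¬ K q s → False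

/-- Distance at most two within `C`. -/
def Near (K : α → α → Prop) (C : Set α) (u v : α) : Prop :=
  ∃ w ∈ C, (u = w ∨ K u w) ∧ (w = v ∨ K w v)

/-- Distance at most two within `C` in the complement. -/
def CoNear (K : α → α → Prop) (C : Set α) (u v : α) : Prop :=
  ∃ w ∈ C, ¬ K u w ∧ ¬ K w v

/-- The complementary relation. -/
def co (K : α → α → Prop) (u v : α) : Prop := u ≠ v ∧ ¬ K u v

theorem near_co (hi : ∀ u, ¬ K u u) (C : Set α) (u v : α) : Near (co K) C u v ↔ CoNear K C u v := by
  have h : ∀ a b, (a = b ∨ co K a b) ↔ ¬ K a b := by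
    intro a b
    by_cases hab : a = b
    · subst hab
      simp [hi]
    · simp [co, hab]
  simp only [Near, CoNear, h]

theorem coNear_co (C : Set α) (u v : α) : CoNear (co K) C u v ↔ Near K C u v := by
  have h : ∀ a b, ¬ co K a b ↔ a = b ∨ K a b := by
    intro a b
    simp only [co]
    tauto
  simp only [Near, CoNear, h]

/-- The four-vertex path is self-complementary: a path `p q r s` in the complement is a path `r p s
q` in `K`. -/
theorem P4Free.co (hs : ∀ u v, K u v → K v u) (h : P4Free K) : P4Free (co K) := by
  intro p q r s hpq hqr hrs hpr hps hqs
  have h1 : p ≠ r := by rintro rfl; exact hps hrs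
  have h2 : p ≠ s := by
    rintro rfl
    exact hqs ⟨hpq.1.symm, fun h => hpq.2 (hs _ _ h)⟩
  have h3 : q ≠ s := by rintro rfl; exact hps hpq
  simp only [Cograph.co, not_and, not_not] at hpr hps hqs
  exact h r p s q (hs _ _ (hpr h1)) (hps h2) (hs _ _ (hqs h3)) hrs.2
    (fun h => hqr.2 (hs _ _ h)) hpq.2

theorem Near.symm (hs : ∀ u v, K u v → K v u) {C : Set α} {u v : α} (h : Near K C u v) :
    Near K C v u := by
  obtain ⟨w, hw, h1, h2⟩ := h
  exact ⟨w, hw, h2.imp Eq.symm (hs _ _), h1.imp Eq.symm (hs _ _)⟩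

/-- A walk `u w t v` with three edges is not an induced path, so it has a shortcut. Hence `Near` is
already connectedness within `C`, although it speaks only of distance two. -/
theorem Near.step (hP : P4Free K) {C : Set α} {u t v : α} (ht : t ∈ C)
    (hv : v ∈ C) (h : Near K C u t) (htv : K t v) : Near K C u v := by
  obtain ⟨w, hw, rfl | h1, rfl | h2⟩ := h
  · exact ⟨v, hv, .inr htv, .inl rfl⟩
  · exact ⟨t, ht, .inr h2, .inr htv⟩
  · exact ⟨w, ht, .inr h1, .inr htv⟩
  · by_cases h3 : K u t
    · exact ⟨t, ht, .inr h3, .inr htv⟩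
    · by_cases h4 : K u v
      · exact ⟨v, hv, .inr h4, .inl rfl⟩
      · by_cases h5 : K w v
        · exact ⟨w, hw, .inr h1, .inr h5⟩
        · exact (hP u w t v h1 h2 htv h3 h4 h5).elim

theorem Near.trans (hP : P4Free K) {C : Set α} {u t v : α} (ht : t ∈ C)
    (hv : v ∈ C) (h : Near K C u t) (h' : Near K C t v) : Near K C u v := by
  obtain ⟨w, hw, h1, h2⟩ := h'
  have h3 : Near K C u w := by
    rcases h1 with rfl | h1
    · exact h
    · exact h.step hP ht hw h1
  rcases h2 with rfl | h2
  · exact h3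
  · exact h3.step hP hw hv h2

theorem CoNear.symm (hs : ∀ u v, K u v → K v u) {C : Set α} {u v : α} (h : CoNear K C u v) :
    CoNear K C v u := by
  obtain ⟨w, hw, h1, h2⟩ := h
  exact ⟨w, hw, fun h => h2 (hs _ _ h), fun h => h1 (hs _ _ h)⟩

theorem CoNear.trans (hs : ∀ u v, K u v → K v u) (hi : ∀ u, ¬ K u u) (hP : P4Free K) {C : Set α}
    {u t v : α} (ht : t ∈ C) (hv : v ∈ C) (h : CoNear K C u t)
    (h' : CoNear K C t v) : CoNear K C u v := by
  rw [← near_co hi] at *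
  exact h.trans (hP.co hs) ht hv h'

/-- A graph with disconnected complement is connected: `a` and `b` are adjacent, and every vertex of
`C` is adjacent to one of them. -/
theorem near_of_not_coNear (hs : ∀ u v, K u v → K v u) (hi : ∀ u, ¬ K u u) (hP : P4Free K)
    {C : Set α} {a b u v : α} (ha : a ∈ C) (hb : b ∈ C) (hu : u ∈ C) (hv : v ∈ C)
    (h : ¬ CoNear K C a b) : Near K C u v := by
  have h' : ∀ w ∈ C, K a w ∨ K w b := by
    intro w hw
    by_contra hc
    exact h ⟨w, hw, by tauto, by tauto⟩
  have hab : K a b := (h' a ha).resolve_left (hi a)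
  rcases h' u hu with h1 | h1 <;> rcases h' v hv with h2 | h2
  · exact ⟨a, ha, .inr (hs _ _ h1), .inr h2⟩
  · have h3 : Near K C u b := ⟨a, ha, .inr (hs _ _ h1), .inr hab⟩
    exact h3.step hP hb hv (hs _ _ h2)
  · have h3 : Near K C u a := ⟨b, hb, .inr h1, .inr (hs _ _ hab)⟩
    exact h3.step hP ha hv h2
  · exact ⟨b, hb, .inr h1, .inr (hs _ _ h2)⟩

/-- Suppose adding `v` to the disconnected `D` gives a connected and co-connected graph. Then `v` is
adjacent to `x` and `y` and has a non-neighbour `z` in `D`. Connectedness yields `t` in `D` adjacent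
to both `z` and `v`. One of `x`, `y` lies in another component of `D` than `t`; calling it `s`, the
path `z t v s` is induced. -/
theorem exists_split_insert (hs : ∀ u v, K u v → K v u) (hP : P4Free K)
    {D : Set α} {v x y : α} (hv : v ∉ D) (hx : x ∈ D) (hy : y ∈ D) (hxy : ¬ Near K D x y) :
    ∃ a ∈ insert v D, ∃ b ∈ insert v D,
      ¬ Near K (insert v D) a b ∨ ¬ CoNear K (insert v D) a b := by
  by_contra hc
  push Not at hc
  have hvC : v ∈ insert v D := Set.mem_insert _ _
  have hx' := Set.mem_insert_of_mem v hx
  have hy' := Set.mem_insert_of_mem v hy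
  have hvx : v ≠ x := by rintro rfl; exact hv hx
  have hvy : v ≠ y := by rintro rfl; exact hv hy
  have hK : K x v ∧ K y v := by
    obtain ⟨w, hw, h1, h2⟩ := (hc x hx' y hy').1
    rcases hw with rfl | hw
    · exact ⟨h1.resolve_left hvx.symm, hs _ _ (h2.resolve_left hvy)⟩
    · exact (hxy ⟨w, hw, h1, h2⟩).elim
  obtain ⟨z, hz, hvz, hzx⟩ := (hc v hvC x hx').2
  have hzv : z ≠ v := by rintro rfl; exact hzx (hs _ _ hK.1)
  have hzD : z ∈ D := hz.resolve_left hzv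
  obtain ⟨t, ht, h1, h2⟩ := (hc z hz v hvC).1
  have htv : t ≠ v := by
    rintro rfl
    exact hvz (hs _ _ (h1.resolve_left hzv))
  have htD : t ∈ D := ht.resolve_left htv
  have h2 : K t v := h2.resolve_left htv
  have h1 : K z t := by
    refine h1.resolve_left ?_
    rintro rfl
    exact hvz (hs _ _ h2)
  obtain ⟨s, hsD, hsv, hts⟩ : ∃ s ∈ D, K s v ∧ ¬ Near K D t s := by
    by_cases h : Near K D t x
    · refine ⟨y, hy, hK.2, fun h' => hxy ?_⟩
      exact (h.symm hs).trans hP htD hy h'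
    · exact ⟨x, hx, hK.1, h⟩
  refine hP z t v s h1 h2 (hs _ _ hsv) (fun h => hvz (hs _ _ h)) (fun h => hts ?_) (fun h => hts ?_)
  · exact ⟨z, hzD, .inr (hs _ _ h1), .inr h⟩
  · exact ⟨s, hsD, .inr h, .inl rfl⟩

/-- A cograph with at least two vertices is not both connected and co-connected. -/
theorem exists_split (hs : ∀ u v, K u v → K v u) (hi : ∀ u, ¬ K u u) (hP : P4Free K)
    {C : Set α} (hC : C.Finite) (hne : C.Nontrivial) :
    ∃ a ∈ C, ∃ b ∈ C, ¬ Near K C a b ∨ ¬ CoNear K C a b := by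
  induction C, hC using Set.Finite.induction_on with
  | empty => exact (Set.not_nontrivial_empty hne).elim
  | @insert v D hv hD ih =>
    rcases D.subsingleton_or_nontrivial with hsub | hnt
    · obtain ⟨z, hz⟩ : D.Nonempty := by
        rw [Set.nonempty_iff_ne_empty]
        rintro rfl
        simp at hne
      obtain rfl : D = {z} := hsub.eq_singleton_of_mem hz
      have hvz : v ≠ z := hv
      refine ⟨v, by simp, z, by simp, ?_⟩
      by_cases hK : K v z
      · right
        rintro ⟨w, rfl | rfl, h1, h2⟩
        · exact h2 hK
        · exact h1 hK
      · left
        rintro ⟨w, rfl | rfl, h1, h2⟩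
        · exact h2.elim hvz hK
        · exact h1.elim hvz hK
    · obtain ⟨x, hx, y, hy, h | h⟩ := ih hnt
      · exact exists_split_insert hs hP hv hx hy h
      -- If the complement on `D` is disconnected, the same argument applies to the complementary
      -- relation.
      · rw [← near_co hi] at h
        have hs' : ∀ u v, co K u v → co K v u := fun u v h => ⟨h.1.symm, fun h' => h.2 (hs _ _ h')⟩
        obtain ⟨a, ha, b, hb, h⟩ := exists_split_insert hs' (hP.co hs) hv hx hy h
        rw [near_co hi, coNear_co] at h
        exact ⟨a, ha, b, hb, h.symm⟩

/-- Refinement of an equivalence relation by splitting its classes into components and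
co-components `j` times. -/
def level (K E₀ : α → α → Prop) : ℕ → α → α → Prop
  | 0 => E₀
  | j + 1 => fun u v => level K E₀ j u v ∧ Near K {w | level K E₀ j u w} u v ∧
      CoNear K {w | level K E₀ j u w} u v

variable {E₀ : α → α → Prop}

theorem level_succ_le {j : ℕ} {u v : α} (h : level K E₀ (j + 1) u v) : level K E₀ j u v := h.1

theorem level_anti {i j : ℕ} (hij : i ≤ j) {u v : α} (h : level K E₀ j u v) : level K E₀ i u v := by
  induction hij with
  | refl => exact h
  | step _ ih => exact ih (level_succ_le h)

theorem class_eq {E : α → α → Prop} (hE : Equivalence E) {u v : α} (h : E u v) :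
    {w | E u w} = {w | E v w} := by
  ext w
  exact ⟨fun h' => hE.trans (hE.symm h) h', fun h' => hE.trans h h'⟩

theorem level_equivalence (hs : ∀ u v, K u v → K v u) (hi : ∀ u, ¬ K u u) (hP : P4Free K)
    (hE : Equivalence E₀) (j : ℕ) : Equivalence (level K E₀ j) := by
  induction j with
  | zero => exact hE
  | succ j ih =>
    refine ⟨fun u => ⟨ih.refl u, ⟨u, ih.refl u, .inl rfl, .inl rfl⟩, ⟨u, ih.refl u, hi u, hi u⟩⟩,
      fun {u v} h => ?_, fun {u v w} h h' => ?_⟩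
    · have hc := class_eq ih h.1
      exact ⟨ih.symm h.1, hc ▸ h.2.1.symm hs, hc ▸ h.2.2.symm hs⟩
    · have hc := class_eq ih h.1
      have hw := ih.trans h.1 h'.1
      obtain ⟨_, h1, h2⟩ := h'
      rw [← hc] at h1 h2
      exact ⟨hw, h.2.1.trans hP h.1 hw h1, h.2.2.trans hs hi hP h.1 hw h2⟩

/-- By `exists_split` a class with at least two elements loses an element at each level, so one
surviving at level `j` has at most `Nat.card α - j` elements. -/
theorem level_trivial (hs : ∀ u v, K u v → K v u) (hi : ∀ u, ¬ K u u) (hP : P4Free K)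
    (hE : Equivalence E₀) [Finite α] {j : ℕ} (hj : Nat.card α ≤ j + 1) {u v : α}
    (h : level K E₀ j u v) : u = v := by
  have key : ∀ j u, {v | level K E₀ j u v}.Nontrivial →
      {v | level K E₀ j u v}.ncard + j ≤ Nat.card α := by
    intro j
    induction j with
    | zero => exact fun u _ => Set.ncard_le_card _
    | succ j ih =>
      intro u hu
      have heq := level_equivalence hs hi hP hE j
      have heq' := level_equivalence hs hi hP hE (j + 1)
      have hsub : {v | level K E₀ (j + 1) u v} ⊆ {v | level K E₀ j u v} :=
        fun v hv => level_succ_le hv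
      have hlt : {v | level K E₀ (j + 1) u v} ⊂ {v | level K E₀ j u v} := by
        refine ⟨hsub, fun hc => ?_⟩
        obtain ⟨a, ha, b, hb, h⟩ := exists_split hs hi hP (Set.toFinite {v | level K E₀ j u v})
          (hu.mono hsub)
        have hab := heq'.trans (heq'.symm (hc ha)) (hc hb)
        rw [class_eq heq ha] at h
        exact h.elim (fun h => h hab.2.1) (fun h => h hab.2.2)
      have := ih u (hu.mono hsub)
      have := Set.ncard_lt_ncard hlt
      omega
  by_contra hne
  have hnt : {v | level K E₀ j u v}.Nontrivial :=
    ⟨u, (level_equivalence hs hi hP hE j).refl u, v, h, hne⟩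
  have h1 := key j u hnt
  have h2 := (Set.one_lt_ncard (Set.toFinite _)).2 hnt
  omega

/-- Isomorphism of the classes of two elements. -/
def ClassIso (K E : α → α → Prop) (u v : α) : Prop :=
  ∃ f : α → α, Set.BijOn f {y | E u y} {y | E v y} ∧
    ∀ y z, E u y → E u z → (K y z ↔ K (f y) (f z))

theorem ClassIso.equivalence (K E : α → α → Prop) : Equivalence (ClassIso K E) where
  refl u := ⟨id, Set.bijOn_id _, fun _ _ _ _ => Iff.rfl⟩
  symm := by
    rintro u v ⟨f, hf, hK⟩
    by_cases hα : Nonempty α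
    · have hinv := hf.invOn_invFunOn
      have hg := hinv.symm.bijOn hf.surjOn.mapsTo_invFunOn hf.mapsTo
      refine ⟨_, hg, fun y z hy hz => ?_⟩
      rw [hK _ _ (hg.mapsTo hy) (hg.mapsTo hz), hinv.2 hy, hinv.2 hz]
    · exact (hα ⟨u⟩).elim
  trans := by
    rintro u v w ⟨f, hf, hK⟩ ⟨g, hg, hK'⟩
    exact ⟨g ∘ f, hg.comp hf, fun y z hy hz => (hK y z hy hz).trans
      (hK' _ _ (hf.mapsTo hy) (hf.mapsTo hz))⟩

/-- The later levels inside a class are defined from `K` with all witnesses in that class, so an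
isomorphism of classes carries them along. -/
theorem level_map_iff {j : ℕ} (heq : ∀ i, Equivalence (level K E₀ i)) {u v : α} {f : α → α}
    (hf : Set.BijOn f {y | level K E₀ j u y} {y | level K E₀ j v y})
    (hK : ∀ y z, level K E₀ j u y → level K E₀ j u z → (K y z ↔ K (f y) (f z)))
    {i : ℕ} (hi : j ≤ i) : ∀ {y z}, level K E₀ j u y → level K E₀ j u z →
      (level K E₀ i y z ↔ level K E₀ i (f y) (f z)) := by
  induction hi with
  | refl =>
    intro y z hy hz
    exact iff_of_true ((heq j).trans ((heq j).symm hy) hz)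
      ((heq j).trans ((heq j).symm (hf.mapsTo hy)) (hf.mapsTo hz))
  | @step i hi ih =>
    intro y z hy hz
    have hK1 : ∀ {a b}, level K E₀ j u a → level K E₀ j u b →
        ((a = b ∨ K a b) ↔ (f a = f b ∨ K (f a) (f b))) := by
      intro a b ha hb
      rw [hK a b ha hb, hf.injOn.eq_iff ha hb]
    have hex : ∀ p q : α → Prop, (∀ w, level K E₀ j u w → (p w ↔ q (f w))) →
        ((∃ w ∈ {w | level K E₀ i y w}, p w) ↔ ∃ w ∈ {w | level K E₀ i (f y) w}, q w) := by
      intro p q hpq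
      constructor
      · rintro ⟨w, hw, h⟩
        have hw' := (heq j).trans hy (level_anti hi hw)
        exact ⟨f w, (ih hy hw').1 hw, (hpq w hw').1 h⟩
      · rintro ⟨w, hw, h⟩
        obtain ⟨w, hw', rfl⟩ := hf.surjOn ((heq j).trans (hf.mapsTo hy) (level_anti hi hw))
        exact ⟨w, (ih hy hw').2 hw, (hpq w hw').2 h⟩
    refine and_congr (ih hy hz) (and_congr (hex _ _ fun w hw => ?_) (hex _ _ fun w hw => ?_))
    · rw [hK1 hy hw, hK1 hw hz]
    · rw [hK y w hy hw, hK w z hw hz]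

theorem bijOn_level {j : ℕ} (heq : ∀ i, Equivalence (level K E₀ i)) {u v : α} {f : α → α}
    (hf : Set.BijOn f {y | level K E₀ j u y} {y | level K E₀ j v y})
    (hK : ∀ y z, level K E₀ j u y → level K E₀ j u z → (K y z ↔ K (f y) (f z)))
    {i : ℕ} (hi : j ≤ i) {y : α} (hy : level K E₀ j u y) :
    Set.BijOn f {z | level K E₀ i y z} {z | level K E₀ i (f y) z} := by
  have hsub : {z | level K E₀ i y z} ⊆ {y | level K E₀ j u y} :=
    fun z hz => (heq j).trans hy (level_anti hi hz)
  refine ⟨fun z hz => (level_map_iff heq hf hK hi hy (hsub hz)).1 hz, hf.injOn.mono hsub,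
    fun z hz => ?_⟩
  obtain ⟨z, hz', rfl⟩ := hf.surjOn ((heq j).trans (hf.mapsTo hy) (level_anti hi hz))
  exact ⟨z, (level_map_iff heq hf hK hi hy hz').2 hz, rfl⟩

/-- Isomorphisms between the classes in two unions of classes, with the same number of vertices in
classes of each isomorphism type, can be put together. -/
theorem exists_glue {E I : α → α → Prop} (hE : Equivalence E) (hI : Equivalence I)
    (hEI : ∀ u v, E u v → I u v) (hIK : ∀ u v, I u v → ClassIso K E u v) [Finite α]
    (P Q : Set α) (hP : ∀ y z, y ∈ P → E y z → z ∈ P) (hQ : ∀ y z, y ∈ Q → E y z → z ∈ Q)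
    (hc : ∀ x, {y | y ∈ P ∧ I y x}.ncard = {y | y ∈ Q ∧ I y x}.ncard) :
    ∃ f : α → α, Set.BijOn f P Q ∧ ∀ y ∈ P, ∀ z ∈ P,
      (E y z ↔ E (f y) (f z)) ∧ (E y z → (K y z ↔ K (f y) (f z))) := by
  classical
  induction hn : P.ncard using Nat.strong_induction_on generalizing P Q with
  | _ n ih =>
  rcases P.eq_empty_or_nonempty with rfl | ⟨a, ha⟩
  · have : Q = ∅ := by
      rw [Set.eq_empty_iff_forall_notMem]
      intro b hb
      have h := hc b
      simp only [Set.mem_empty_iff_false, false_and, Set.ofPred_false, Set.ncard_empty] at h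
      have := (Set.ncard_eq_zero (Set.toFinite _)).1 h.symm
      exact (this ▸ (⟨hb, hI.refl b⟩ : b ∈ {y | y ∈ Q ∧ I y b}) : b ∈ (∅ : Set α))
    subst this
    exact ⟨id, Set.bijOn_id _, by simp⟩
  · obtain ⟨b, hb, hba⟩ : ∃ b ∈ Q, I b a := by
      have h : 0 < {y | y ∈ P ∧ I y a}.ncard := (Set.ncard_pos (Set.toFinite _)).2 ⟨a, ha, hI.refl a⟩
      rw [hc a, Set.ncard_pos (Set.toFinite _)] at h
      exact h
    obtain ⟨g, hg, hgK⟩ := hIK a b (hI.symm hba)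
    have hsubP : {y | E a y} ⊆ P := fun y hy => hP a y ha hy
    have hsubQ : {y | E b y} ⊆ Q := fun y hy => hQ b y hb hy
    have hcard : {y | E a y}.ncard = {y | E b y}.ncard := by
      rw [← hg.image_eq, hg.injOn.ncard_image]
    -- Since `E` refines `I`, each `I`-class contains the `E`-class of `a` or is disjoint from it.
    -- Removing isomorphic classes from both sides thus keeps all counts equal.
    have hcount : ∀ (P : Set α) (a : α), {y | E a y} ⊆ P → ∀ x,
        {y | y ∈ P ∧ I y x}.ncard = {y | y ∈ P \ {y | E a y} ∧ I y x}.ncard +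
          if I a x then {y | E a y}.ncard else 0 := by
      intro P a hsub x
      split_ifs with hax
      · rw [← Set.ncard_union_eq ?_ (Set.toFinite _) (Set.toFinite _)]
        · congr 1
          ext y
          constructor
          · rintro ⟨h1, h2⟩
            by_cases h : E a y
            · exact .inr h
            · exact .inl ⟨⟨h1, h⟩, h2⟩
          · rintro (⟨⟨h1, h⟩, h2⟩ | h)
            · exact ⟨h1, h2⟩
            · exact ⟨hsub h, hI.trans (hI.symm (hEI _ _ h)) hax⟩
        · rw [Set.disjoint_left]
          rintro y ⟨⟨_, h⟩, _⟩ h'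
          exact h h'
      · rw [add_zero]
        congr 1
        ext y
        refine ⟨fun ⟨h1, h2⟩ => ⟨⟨h1, fun h => hax ?_⟩, h2⟩, fun ⟨h1, h2⟩ => ⟨h1.1, h2⟩⟩
        exact hI.trans (hEI _ _ h) h2
    have hclosed : ∀ (P : Set α) (a : α), (∀ y z, y ∈ P → E y z → z ∈ P) →
        ∀ y z, y ∈ P \ {y | E a y} → E y z → z ∈ P \ {y | E a y} := by
      intro P a hP y z hy hyz
      exact ⟨hP y z hy.1 hyz, fun h => hy.2 (hE.trans h (hE.symm hyz))⟩
    have hlt : (P \ {y | E a y}).ncard < n := by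
      rw [← hn]
      refine Set.ncard_lt_ncard ⟨Set.sdiff_subset, fun h => ?_⟩
      exact (h ha).2 (hE.refl a)
    obtain ⟨f, hf, hfK⟩ := ih _ hlt (P \ {y | E a y}) (Q \ {y | E b y}) (hclosed P a hP)
      (hclosed Q b hQ) (fun x => by
        have h1 := hcount P a hsubP x
        have h2 := hcount Q b hsubQ x
        have h3 : I a x ↔ I b x :=
          ⟨fun h => hI.trans hba h, fun h => hI.trans (hI.symm hba) h⟩
        simp only [h3, hcard] at h1
        have := hc x
        omega) rfl
    have hF1 : ∀ y, E a y → (if E a y then g y else f y) = g y := fun y hy => if_pos hy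
    have hF2 : ∀ y, ¬ E a y → (if E a y then g y else f y) = f y := fun y hy => if_neg hy
    refine ⟨fun y => if E a y then g y else f y, ?_, fun y hy z hz => ?_⟩
    · have h1 : Set.BijOn (fun y => if E a y then g y else f y) {y | E a y} {y | E b y} :=
        hg.congr fun y hy => (hF1 y hy).symm
      have h2 : Set.BijOn (fun y => if E a y then g y else f y) (P \ {y | E a y})
          (Q \ {y | E b y}) := hf.congr fun y hy => (hF2 y hy.2).symm
      have h3 := h2.union h1 (by
        rw [Set.injOn_union Set.disjoint_sdiff_left]
        refine ⟨h2.injOn, h1.injOn, fun y hy z hz h => ?_⟩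
        have := h2.mapsTo hy
        rw [h] at this
        exact this.2 (h1.mapsTo hz))
      rwa [Set.sdiff_union_of_subset hsubP, Set.sdiff_union_of_subset hsubQ] at h3
    · by_cases hay : E a y <;> by_cases haz : E a z
      · simp only [hF1 y hay, hF1 z haz]
        exact ⟨iff_of_true (hE.trans (hE.symm hay) haz)
          (hE.trans (hE.symm (hg.mapsTo hay)) (hg.mapsTo haz)), fun _ => hgK y z hay haz⟩
      · simp only [hF1 y hay, hF2 z haz]
        have h1 : ¬ E y z := fun h => haz (hE.trans hay h)
        have h2 : ¬ E (g y) (f z) := fun h => (hf.mapsTo ⟨hz, haz⟩).2 (hE.trans (hg.mapsTo hay) h)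
        exact ⟨iff_of_false h1 h2, fun h => (h1 h).elim⟩
      · simp only [hF2 y hay, hF1 z haz]
        have h1 : ¬ E y z := fun h => hay (hE.trans haz (hE.symm h))
        have h2 : ¬ E (f y) (g z) := fun h =>
          (hf.mapsTo ⟨hy, hay⟩).2 (hE.trans (hg.mapsTo haz) (hE.symm h))
        exact ⟨iff_of_false h1 h2, fun h => (h1 h).elim⟩
      · simp only [hF2 y hay, hF2 z haz]
        exact hfK y ⟨hy, hay⟩ z ⟨hz, haz⟩

/-- Some two elements of the `E`-class of `u` in different `E'`-classes are not adjacent. -/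
def Sparse (K E E' : α → α → Prop) (u : α) : Prop :=
  ∃ y z, E u y ∧ E u z ∧ ¬ E' y z ∧ ¬ K y z

/-- Between different parts of a class adjacency is constant. An adjacent pair in different parts
shows that the complement is disconnected, a non-adjacent pair that the graph is; both together
contradict `near_of_not_coNear`. -/
theorem adj_iff_not_sparse (hs : ∀ u v, K u v → K v u) (hi : ∀ u, ¬ K u u) (hP : P4Free K)
    (hE : Equivalence E₀) {j : ℕ} {u x y : α} (hx : level K E₀ j u x) (hy : level K E₀ j u y)
    (hxy : ¬ level K E₀ (j + 1) x y) :
    K x y ↔ ¬ Sparse K (level K E₀ j) (level K E₀ (j + 1)) u := by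
  have heq := level_equivalence hs hi hP hE j
  constructor
  · rintro hK ⟨a, b, ha, hb, hab, hnK⟩
    have h1 : ¬ CoNear K {w | level K E₀ j u w} x y := by
      rw [class_eq heq hx]
      exact fun h => hxy ⟨heq.trans (heq.symm hx) hy,
        ⟨y, heq.trans (heq.symm hx) hy, .inr hK, .inl rfl⟩, h⟩
    have h2 : ¬ Near K {w | level K E₀ j u w} a b := by
      rw [class_eq heq ha]
      exact fun h => hab ⟨heq.trans (heq.symm ha) hb, h, ⟨a, heq.refl a, hi a, hnK⟩⟩
    exact h2 (near_of_not_coNear hs hi hP hx hy ha hb h1)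
  · intro h
    by_contra hK
    exact h ⟨x, y, hx, hy, hxy, hK⟩

/-- The recursive isomorphism test for the modules of a cograph. -/
theorem test_iff_classIso (hs : ∀ u v, K u v → K v u) (hi : ∀ u, ¬ K u u) (hP : P4Free K)
    (hE : Equivalence E₀) [Finite α] (J : ℕ → α → α → Prop)
    (hJ : ∀ j < Nat.card α, ∀ u v, J j u v ↔ ∀ i, j < i → i < Nat.card α →
      (Sparse K (level K E₀ j) (level K E₀ i) u ↔ Sparse K (level K E₀ j) (level K E₀ i) v) ∧
      ∀ x, {y | level K E₀ j u y ∧ J i y x}.ncard = {y | level K E₀ j v y ∧ J i y x}.ncard)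
    {j : ℕ} (hj : j < Nat.card α) (u v : α) :
    J j u v ↔ ClassIso K (level K E₀ j) u v := by
  have heq := level_equivalence hs hi hP hE
  induction hd : Nat.card α - j using Nat.strong_induction_on generalizing j u v with
  | _ d ih =>
  rw [hJ j hj]
  constructor
  · intro h
    rcases Nat.lt_or_ge (j + 1) (Nat.card α) with hj' | hj'
    -- Only the next level is needed here. Counting vertices instead of parts loses nothing, because
    -- isomorphic parts have the same size. Gluing respects the pairs inside a part, and `Sparse`
    -- decides the pairs between parts.
    · obtain ⟨hsp, hc⟩ := h (j + 1) (by omega) hj'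
      have hJI : J (j + 1) = ClassIso K (level K E₀ (j + 1)) := by
        funext a b
        exact propext (ih _ (by omega) hj' a b rfl)
      rw [hJI] at hc
      have hEI : ∀ a b, level K E₀ (j + 1) a b → ClassIso K (level K E₀ (j + 1)) a b := by
        intro a b hab
        refine ⟨id, ?_, fun _ _ _ _ => Iff.rfl⟩
        rw [class_eq (heq (j + 1)) hab]
        exact Set.bijOn_id _
      obtain ⟨f, hf, hfK⟩ := exists_glue (heq (j + 1)) (ClassIso.equivalence K _) hEI
        (fun _ _ h => h) {y | level K E₀ j u y} {y | level K E₀ j v y}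
        (fun y z hy hyz => (heq j).trans hy (level_succ_le hyz))
        (fun y z hy hyz => (heq j).trans hy (level_succ_le hyz)) hc
      refine ⟨f, hf, fun y z hy hz => ?_⟩
      obtain ⟨h1, h2⟩ := hfK y hy z hz
      by_cases hyz : level K E₀ (j + 1) y z
      · exact h2 hyz
      · rw [adj_iff_not_sparse hs hi hP hE hy hz hyz, hsp,
          adj_iff_not_sparse hs hi hP hE (hf.mapsTo hy) (hf.mapsTo hz) (fun h => hyz (h1.2 h))]
    -- At the last level the condition is vacuous, rightly so: all classes are singletons.
    · have htriv : ∀ a, {b | level K E₀ j a b} = {a} := by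
        intro a
        ext b
        exact ⟨fun h => (level_trivial hs hi hP hE hj' h).symm, fun h => h ▸ (heq j).refl a⟩
      refine ⟨fun _ => v, ?_, fun y z hy hz => ?_⟩
      · rw [htriv, htriv, Set.bijOn_singleton]
      · have hy' := level_trivial hs hi hP hE hj' hy
        have hz' := level_trivial hs hi hP hE hj' hz
        subst hy' hz'
        exact iff_of_false (hi _) (hi _)
  -- An isomorphism preserves every deeper level, so the test may quantify over all `i > j`; no
  -- successor function is then needed to express it.
  · rintro ⟨f, hf, hK⟩ i hij hin
    have hJI : J i = ClassIso K (level K E₀ i) := by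
      funext a b
      exact propext (ih _ (by omega) hin a b rfl)
    constructor
    · constructor
      · rintro ⟨y, z, hy, hz, hyz, hn⟩
        exact ⟨f y, f z, hf.mapsTo hy, hf.mapsTo hz,
          fun h => hyz ((level_map_iff heq hf hK hij.le hy hz).2 h), fun h => hn ((hK y z hy hz).2 h)⟩
      · rintro ⟨y, z, hy, hz, hyz, hn⟩
        obtain ⟨y, hy', rfl⟩ := hf.surjOn hy
        obtain ⟨z, hz', rfl⟩ := hf.surjOn hz
        exact ⟨y, z, hy', hz', fun h => hyz ((level_map_iff heq hf hK hij.le hy' hz').1 h),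
          fun h => hn ((hK y z hy' hz').1 h)⟩
    · intro x
      rw [hJI]
      have hiff : ∀ y, level K E₀ j u y →
          (ClassIso K (level K E₀ i) y x ↔ ClassIso K (level K E₀ i) (f y) x) := by
        intro y hy
        have h1 : ClassIso K (level K E₀ i) y (f y) :=
          ⟨f, bijOn_level heq hf hK hij.le hy, fun a b ha hb =>
            hK a b ((heq j).trans hy (level_anti hij.le ha)) ((heq j).trans hy (level_anti hij.le hb))⟩
        have he := ClassIso.equivalence K (level K E₀ i)
        exact ⟨fun h => he.trans (he.symm h1) h, fun h => he.trans h1 h⟩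
      have himg : f '' {y | level K E₀ j u y ∧ ClassIso K (level K E₀ i) y x} =
          {y | level K E₀ j v y ∧ ClassIso K (level K E₀ i) y x} := by
        ext y
        constructor
        · rintro ⟨y, ⟨hy, h⟩, rfl⟩
          exact ⟨hf.mapsTo hy, (hiff y hy).1 h⟩
        · rintro ⟨hy, h⟩
          obtain ⟨y, hy', rfl⟩ := hf.surjOn hy
          exact ⟨y, ⟨hy', (hiff y hy').2 h⟩, rfl⟩
      rw [← himg, (hf.injOn.mono fun y hy => hy.1).ncard_image]

end Cograph

/-! ### Decompositions in terms of one side, and the polynomially many candidates. -/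

namespace Cograph

variable {α : Type*} (G : SimpleGraph α)

/-- The edges of `G` within `A` and the non-edges of `G` outside `A`. -/
def sideRel (A : Set α) (u v : α) : Prop :=
  u ≠ v ∧ (u ∈ A ↔ v ∈ A) ∧ (G.Adj u v ↔ u ∈ A)

/-- Being on the same side of `A`. -/
def SameSide (A : Set α) (u v : α) : Prop := u ∈ A ↔ v ∈ A

/-- The set `A` and its complement form a decomposition of the required kind. -/
structure Good (A : Set α) : Prop where
  cut : ∀ u, ∃! v, G.Adj u v ∧ ¬ (u ∈ A ↔ v ∈ A)
  p4Free : P4Free (sideRel G A)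
  iso : ∀ u ∈ A, ∀ v ∉ A, ClassIso (sideRel G A) (SameSide A) u v

/-- The candidates for one side of a decomposition. -/
def candidate (x y a b : α) : Set α := {u | (G.Adj x u ∨ G.Adj y u) ∧ u ≠ a ∧ u ≠ b}

variable {G}

theorem sideRel_symm (A : Set α) (u v : α) (h : sideRel G A u v) : sideRel G A v u :=
  ⟨h.1.symm, h.2.1.symm, by rw [G.adj_comm, h.2.2, h.2.1]⟩

theorem sideRel_irrefl (A : Set α) (u : α) : ¬ sideRel G A u u := fun h => h.1 rfl

theorem sameSide_equivalence (A : Set α) : Equivalence (SameSide A) :=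
  ⟨fun _ => Iff.rfl, Iff.symm, Iff.trans⟩

theorem edgeCut_compl_adj (A : Set α) (u v : α) :
    (edgeCut G A Aᶜ).Adj u v ↔ G.Adj u v ∧ ¬ (u ∈ A ↔ v ∈ A) := by
  simp only [edgeCut, Set.mem_compl_iff]
  tauto

/-- On `A` the relation `sideRel` is adjacency, on the complement it is non-adjacency, so an
isomorphism of the two sides is an isomorphism of one graph with the complement of the other. The
matching makes both sides nonempty as soon as there is a vertex. -/
theorem Good.hasCographDecomposition {A : Set α} (h : Good G A) : HasCographDecomposition G := by
  refine ⟨A, Aᶜ, isCompl_compl, ?_, ⟨fun f => ?_⟩, ?_⟩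
  · obtain ⟨f, hf, hK⟩ : ∃ f : α → α, Set.BijOn f A Aᶜ ∧
        ∀ y ∈ A, ∀ z ∈ A, (sideRel G A y z ↔ sideRel G A (f y) (f z)) := by
      by_cases hne : Nonempty α
      · obtain ⟨u⟩ := hne
        obtain ⟨v, hv⟩ := (h.cut u).exists
        obtain ⟨x, hx, y, hy⟩ : ∃ x ∈ A, ∃ y, y ∉ A := by
          by_cases hu : u ∈ A
          · exact ⟨u, hu, v, by tauto⟩
          · exact ⟨v, by tauto, u, hu⟩
        obtain ⟨f, hf, hK⟩ := h.iso x hx y hy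
        have h1 : {w | SameSide A x w} = A := by ext w; simp [SameSide, hx]
        have h2 : {w | SameSide A y w} = Aᶜ := by ext w; simp [SameSide, hy]
        rw [h1, h2] at hf
        exact ⟨f, hf, fun y hy z hz => hK y z (h1.symm ▸ hy : y ∈ {w | SameSide A x w})
          (h1.symm ▸ hz : z ∈ {w | SameSide A x w})⟩
      · rw [not_nonempty_iff] at hne
        exact ⟨id, ⟨fun x => isEmptyElim x, fun x => isEmptyElim x, fun x => isEmptyElim x⟩,
          fun x => isEmptyElim x⟩
    refine ⟨(RelIso.symm ⟨hf.equiv, ?_⟩ : _ ≃r _)⟩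
    rintro ⟨y, hy⟩ ⟨z, hz⟩
    have h1 := hK y hy z hz
    have h2 := hf.injOn.eq_iff hy hz
    have h3 : f y ∉ A := hf.mapsTo hy
    have h4 : f z ∉ A := hf.mapsTo hz
    have h5 : G.Adj (f y) (f z) → f y ≠ f z := fun h => h.ne
    have h6 : G.Adj y z → y ≠ z := fun h => h.ne
    simp only [sideRel, hy, hz, h3, h4, iff_true, iff_false, true_and] at h1
    simp only [Set.BijOn.equiv, SimpleGraph.comap_adj, SimpleGraph.compl_adj, ne_eq,
      Subtype.mk.injEq, Function.Embedding.subtype_apply, Equiv.ofBijective_apply,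
      Set.MapsTo.val_restrict_apply]
    tauto
  · have hadj : ∀ i j, sideRel G A (f i) (f j) ↔ (SimpleGraph.pathGraph 4).Adj i j := by
      intro i j
      rw [← f.map_rel_iff]
      simp only [sideRel, (f i).2, (f j).2, iff_true, true_and, SimpleGraph.comap_adj,
        Function.Embedding.subtype_apply]
      exact ⟨fun h => h.2, fun h => ⟨h.ne, h⟩⟩
    refine h.p4Free (f 0) (f 1) (f 2) (f 3) ?_ ?_ ?_ ?_ ?_ ?_ <;> rw [hadj] <;>
      simp [SimpleGraph.pathGraph_adj]
  · rw [SimpleGraph.Subgraph.isPerfectMatching_iff]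
    simpa only [edgeCut_compl_adj] using h.cut

theorem not_isCograph {p q r s : α} (hpq : G.Adj p q) (hqr : G.Adj q r) (hrs : G.Adj r s)
    (hpr : ¬ G.Adj p r) (hps : ¬ G.Adj p s) (hqs : ¬ G.Adj q s) : ¬ IsCograph G := by
  have h1 : p ≠ r := by rintro rfl; exact hps hrs
  have h2 : p ≠ s := by rintro rfl; exact hqs hpq.symm
  have h3 : q ≠ s := by rintro rfl; exact hps hpq
  have hrp : ¬ G.Adj r p := fun h => hpr h.symm
  have hsp : ¬ G.Adj s p := fun h => hps h.symm
  have hsq : ¬ G.Adj s q := fun h => hqs h.symm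
  refine fun hco => hco.false ⟨⟨![p, q, r, s], ?_⟩, ?_⟩
  · intro i j hij
    fin_cases i <;> fin_cases j <;>
      simp [h1, h2, h3, h1.symm, h2.symm, h3.symm, hpq.ne, hqr.ne, hrs.ne, hpq.ne.symm, hqr.ne.symm,
        hrs.ne.symm] at hij ⊢
  · intro i j
    change G.Adj (![p, q, r, s] i) (![p, q, r, s] j) ↔ _
    fin_cases i <;> fin_cases j <;>
      simp [SimpleGraph.pathGraph_adj, hpq, hqr, hrs, hpr, hps, hqs, hpq.symm, hqr.symm, hrs.symm,
        hrp, hsp, hsq]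

/-- Pairs across the cut are unrelated, so an induced path lies on one side; if that is the second
side, the given isomorphism moves it to the first. -/
theorem exists_good_of_hasCographDecomposition (h : HasCographDecomposition G) :
    ∃ A, Good G A := by
  obtain ⟨A, B, hAB, ⟨f⟩, hco, hm⟩ := h
  obtain rfl : B = Aᶜ := hAB.compl_eq.symm
  have hK : ∀ y z : ↥A, sideRel G A y z ↔ sideRel G A (f.symm y) (f.symm z) := by
    intro y z
    have h1 := f.symm.map_rel_iff (a := y) (b := z)
    have h3 : (f.symm y : α) ∉ A := (f.symm y).2
    have h4 : (f.symm z : α) ∉ A := (f.symm z).2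
    have h5 : (f.symm y : α) = f.symm z ↔ (y : α) = z := by
      rw [Subtype.coe_inj, Subtype.coe_inj, f.symm.injective.eq_iff]
    have h6 : (y : α) = z ↔ y = z := Subtype.coe_inj
    simp only [SimpleGraph.comap_adj, Function.Embedding.subtype_apply, SimpleGraph.compl_adj,
      ne_eq] at h1
    simp only [sideRel, y.2, z.2, h3, h4, iff_true, iff_false, true_and, ne_eq, h5]
    tauto
  have hA : ∀ p q r s : ↥A, sideRel G A p q → sideRel G A q r → sideRel G A r s →
      ¬ sideRel G A p r → ¬ sideRel G A p s → ¬ sideRel G A q s → False := by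
    intro p q r s hpq hqr hrs hpr hps hqs
    have hadj : ∀ y z : ↥A, sideRel G A y z ↔ G.Adj y z := by
      intro y z
      simp only [sideRel, y.2, z.2, iff_true, true_and]
      exact ⟨fun h => h.2, fun h => ⟨h.ne, h⟩⟩
    rw [hadj] at hpq hqr hrs hpr hps hqs
    exact not_isCograph (G := G.induce A) (p := p) (q := q) (r := r) (s := s) hpq hqr hrs hpr hps
      hqs hco
  refine ⟨A, ⟨?_, ?_, ?_⟩⟩
  · rw [SimpleGraph.Subgraph.isPerfectMatching_iff] at hm
    simpa only [edgeCut_compl_adj] using hm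
  · intro p q r s hpq hqr hrs hpr hps hqs
    by_cases hp : p ∈ A
    · have hq := hpq.2.1.1 hp
      have hr := hqr.2.1.1 hq
      have hs := hrs.2.1.1 hr
      exact hA ⟨p, hp⟩ ⟨q, hq⟩ ⟨r, hr⟩ ⟨s, hs⟩ hpq hqr hrs hpr hps hqs
    · have hq := fun h => hp (hpq.2.1.2 h)
      have hr := fun h => hq (hqr.2.1.2 h)
      have hs := fun h => hr (hrs.2.1.2 h)
      refine hA (f ⟨p, hp⟩) (f ⟨q, hq⟩) (f ⟨r, hr⟩) (f ⟨s, hs⟩) ?_ ?_ ?_ ?_ ?_ ?_ <;>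
        rw [hK] <;> simpa
  · intro u hu v hv
    classical
    have h1 : {w | SameSide A u w} = A := by ext w; simp [SameSide, hu]
    have h2 : {w | SameSide A v w} = Aᶜ := by ext w; simp [SameSide, hv]
    refine ⟨fun w => if hw : w ∈ A then f.symm ⟨w, hw⟩ else w, ?_, fun y z hy hz => ?_⟩
    · rw [h1, h2]
      refine ⟨fun w hw => ?_, fun w hw w' hw' h => ?_, fun w hw => ?_⟩
      · simp [hw]
      · simp only [hw, hw', dif_pos] at h
        have := f.symm.injective (Subtype.coe_injective h)
        simpa using this
      · refine ⟨f ⟨w, hw⟩, (f ⟨w, hw⟩).2, ?_⟩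
        simp
    · have hy' : y ∈ A := hy.1 hu
      have hz' : z ∈ A := hz.1 hu
      simp only [hy', hz', dif_pos]
      exact hK ⟨y, hy'⟩ ⟨z, hz'⟩

/-- Exchanging the sides complements `sideRel` within each side, and both the path on four vertices
and isomorphism are compatible with complementation. -/
theorem Good.compl {A : Set α} (h : Good G A) : Good G Aᶜ := by
  have hR : ∀ u v, sideRel G Aᶜ u v ↔ u ≠ v ∧ (u ∈ A ↔ v ∈ A) ∧ ¬ sideRel G A u v := by
    intro u v
    simp only [sideRel, Set.mem_compl_iff]
    tauto
  refine ⟨?_, ?_, ?_⟩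
  · simpa only [Set.mem_compl_iff, not_iff_not] using h.cut
  · intro p q r s hpq hqr hrs hpr hps hqs
    have h1 : p ≠ r := by rintro rfl; exact hps hrs
    have h2 : p ≠ s := by rintro rfl; exact hqs (sideRel_symm _ _ _ hpq)
    have h3 : q ≠ s := by rintro rfl; exact hps hpq
    rw [hR] at hpq hqr hrs hpr hps hqs
    have hpr' : sideRel G A p r := by
      by_contra hn
      exact hpr ⟨h1, hpq.2.1.trans hqr.2.1, hn⟩
    have hps' : sideRel G A p s := by
      by_contra hn
      exact hps ⟨h2, hpq.2.1.trans (hqr.2.1.trans hrs.2.1), hn⟩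
    have hqs' : sideRel G A q s := by
      by_contra hn
      exact hqs ⟨h3, hqr.2.1.trans hrs.2.1, hn⟩
    exact h.p4Free r p s q (sideRel_symm _ _ _ hpr') hps' (sideRel_symm _ _ _ hqs') hrs.2.2
      (fun h => hqr.2.2 (sideRel_symm _ _ _ h)) hpq.2.2
  · intro u hu v hv
    have hS : SameSide Aᶜ = SameSide A := by
      funext a b
      simp [SameSide, not_iff_not]
    rw [Set.notMem_compl_iff] at hv
    have he := ClassIso.equivalence (sideRel G A) (SameSide A)
    obtain ⟨f, hf, hK⟩ := he.symm (h.iso v hv u hu)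
    rw [hS]
    refine ⟨f, hf, fun y z hy hz => ?_⟩
    have h1 : y ∈ A ↔ z ∈ A := hy.symm.trans hz
    have h2 : f y ∈ A ↔ f z ∈ A := (hf.mapsTo hy).symm.trans (hf.mapsTo hz)
    rw [hR, hR, hK y z hy hz, ne_eq, ne_eq, hf.injOn.eq_iff hy hz]
    simp only [h1, h2]

/-- The witnesses are the matching partners of `x` and `y`, their only neighbours outside `A`. -/
theorem exists_candidate_eq {A : Set α} (hcut : ∀ u, ∃! v, G.Adj u v ∧ ¬ (u ∈ A ↔ v ∈ A))
    {x y : α} (hx : x ∈ A) (hy : y ∈ A) (h : ∀ w ∈ A, G.Adj x w ∨ G.Adj y w) :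
    ∃ a b, candidate G x y a b = A := by
  obtain ⟨a, ⟨ha, ha'⟩, hau⟩ := hcut x
  obtain ⟨b, ⟨hb, hb'⟩, hbu⟩ := hcut y
  refine ⟨a, b, ?_⟩
  ext u
  constructor
  · rintro ⟨h1 | h1, h2, h3⟩
    · by_contra hu
      exact h2 (hau u ⟨h1, by tauto⟩)
    · by_contra hu
      exact h3 (hbu u ⟨h1, by tauto⟩)
  · intro hu
    refine ⟨h u hu, ?_, ?_⟩
    · rintro rfl
      tauto
    · rintro rfl
      tauto

theorem Good.exists_candidate [Finite α] [Nonempty α] {A : Set α} (h : Good G A) :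
    ∃ x y a b, Good G (candidate G x y a b) := by
  suffices hs : ∃ x y a b, candidate G x y a b = A ∨ candidate G x y a b = Aᶜ by
    obtain ⟨x, y, a, b, h' | h'⟩ := hs
    · exact ⟨x, y, a, b, h' ▸ h⟩
    · exact ⟨x, y, a, b, h' ▸ h.compl⟩
  obtain ⟨x, hx, y, hxy, hy⟩ : ∃ x ∈ A, ∃ y, G.Adj x y ∧ y ∉ A := by
    obtain ⟨u⟩ := ‹Nonempty α›
    obtain ⟨v, hv, hv'⟩ := (h.cut u).exists
    by_cases hu : u ∈ A
    · exact ⟨u, hu, v, hv, by tauto⟩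
    · exact ⟨v, by tauto, u, hv.symm, hu⟩
  obtain ⟨f, hf, hK⟩ := h.iso x hx y hy
  have h1 : {w | SameSide A x w} = A := by ext w; simp [SameSide, hx]
  have h2 : {w | SameSide A y w} = Aᶜ := by ext w; simp [SameSide, hy]
  have hm : ∀ w ∈ A, SameSide A x w := fun w hw => iff_of_true hx hw
  rw [h1, h2] at hf
  rcases A.subsingleton_or_nontrivial with hA | hA
  · have hA' : A = {x} := hA.eq_singleton_of_mem hx
    have hAc : ∀ w, w ∉ A → w = y := by
      intro w hw
      obtain ⟨a, ha, rfl⟩ := hf.surjOn hw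
      obtain ⟨b, hb, rfl⟩ := hf.surjOn hy
      rw [hA ha hb]
    -- Here the graph is a single edge `xy` and `A = {x}` is the neighbourhood of `y`; the excluded
    -- vertex `y` is a dummy.
    refine ⟨y, y, y, y, .inl ?_⟩
    ext w
    constructor
    · rintro ⟨_, hw, _⟩
      by_contra h
      exact hw (hAc w h)
    · intro hw
      obtain rfl := hA hw hx
      exact ⟨.inl hxy.symm, hxy.ne, hxy.ne⟩
  · obtain ⟨a, ha, b, hb, h' | h'⟩ := exists_split (sideRel_symm A) (sideRel_irrefl A) h.p4Free
      (Set.toFinite A) hA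
    -- If `G[A]` is disconnected, every vertex of `A` is distinct from and non-adjacent to `a` or
    -- `b`. Applying `f` turns this into adjacency, so `f a` and `f b` describe the other side.
    · have hcut : ∀ u, ∃! v, G.Adj u v ∧ ¬ (u ∈ Aᶜ ↔ v ∈ Aᶜ) := h.compl.cut
      obtain ⟨c, d, hcd⟩ := exists_candidate_eq hcut (hf.mapsTo ha) (hf.mapsTo hb) (fun w hw => by
        obtain ⟨w, hwA, rfl⟩ := hf.surjOn hw
        have key : ∀ c ∈ A, c ≠ w → ¬ sideRel G A c w → G.Adj (f c) (f w) := by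
          intro c hc hcw hn
          have h3 := hf.mapsTo hc
          have h4 : f c ≠ f w := fun h => hcw (hf.injOn hc hwA h)
          rw [hK c w (hm c hc) (hm w hwA)] at hn
          simp only [Set.mem_compl_iff] at h3 hw
          simp only [sideRel] at hn
          tauto
        by_contra hc
        push Not at hc
        refine h' ⟨w, hwA, ?_, ?_⟩
        · by_contra h5
          push Not at h5
          exact hc.1 (key a ha h5.1 h5.2)
        · by_contra h5
          push Not at h5
          exact hc.2 (key b hb h5.1.symm fun h => h5.2 (sideRel_symm _ _ _ h)))
      exact ⟨_, _, c, d, .inr hcd⟩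
    -- If the complement of `G[A]` is disconnected, `a` and `b` themselves describe `A`.
    · obtain ⟨c, d, hcd⟩ := exists_candidate_eq h.cut ha hb (fun w hw => by
        by_contra hc
        push Not at hc
        refine h' ⟨w, hw, fun h => hc.1 ((h.2.2).2 ha), fun h => hc.2 ?_⟩
        exact ((sideRel_symm _ _ _ h).2.2).2 hb)
      exact ⟨_, _, c, d, .inl hcd⟩

theorem hasCographDecomposition_iff [Finite α] : HasCographDecomposition G ↔
    IsEmpty α ∨ ∃ x y a b, Good G (candidate G x y a b) := by
  constructor
  · intro h
    obtain ⟨A, hA⟩ := exists_good_of_hasCographDecomposition h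
    rcases isEmpty_or_nonempty α with he | hne
    · exact .inl he
    · exact .inr hA.exists_candidate
  · rintro (he | ⟨x, y, a, b, h⟩)
    · exact Good.hasCographDecomposition (A := ∅) ⟨fun u => isEmptyElim u, fun p => isEmptyElim p,
        fun u => isEmptyElim u⟩
    · exact h.hasCographDecomposition

end Cograph

/-! ### Semantics of the derived connectives and quantifiers. -/

namespace StackProgram

open Function

variable {ι ρ : Type} [DecidableEq ι] {n : ℕ} {L : ρ → List Bool} {e : ι → Fin n}

namespace Fml

/-- Truth of a formula. -/
def Sat (n : ℕ) (L : ρ → List Bool) (φ : Fml ι ρ) (e : ι → Fin n) : Prop :=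
  φ.eval n L (fun z => e z) = true

/-- The true formula. -/
def tt : Fml ι ρ := nand ff ff
/-- Negation. -/
def neg (φ : Fml ι ρ) : Fml ι ρ := nand φ tt
/-- Conjunction. -/
def and (φ ψ : Fml ι ρ) : Fml ι ρ := neg (nand φ ψ)
/-- Implication. -/
def imp (φ ψ : Fml ι ρ) : Fml ι ρ := nand φ (neg ψ)
/-- Disjunction. -/
def or (φ ψ : Fml ι ρ) : Fml ι ρ := imp (neg φ) ψ
/-- Equivalence. -/
def iff (φ ψ : Fml ι ρ) : Fml ι ρ := and (imp φ ψ) (imp ψ φ)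
/-- Universal quantification. -/
def all (x : ι) (φ : Fml ι ρ) : Fml ι ρ := cnt x (neg φ) ff
/-- Existential quantification. -/
def ex (x : ι) (φ : Fml ι ρ) : Fml ι ρ := neg (cnt x φ ff)
/-- Equality of the numbers of elements satisfying two formulas. -/
def cntEq (x : ι) (φ ψ : Fml ι ρ) : Fml ι ρ := and (cnt x φ ψ) (cnt x ψ φ)
/-- Equality. -/
def eq (x y : ι) : Fml ι ρ := and (le x y) (le y x)

theorem sat_tab {r : ρ} {xs : List ι} :
    Sat n L (tab r xs) e ↔ (L r).getD (tupleIdx n 0 (xs.map fun z => (e z : ℕ))) false = true := Iff.rfl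

theorem sat_le {x y : ι} : Sat n L (le x y) e ↔ e x ≤ e y := by simp [Sat, eval]

theorem sat_tt : Sat n L tt e := by simp [Sat, eval, tt]

theorem sat_neg {φ : Fml ι ρ} : Sat n L (neg φ) e ↔ ¬ Sat n L φ e := by
  simp [Sat, eval, neg, tt]

theorem sat_and {φ ψ : Fml ι ρ} : Sat n L (and φ ψ) e ↔ Sat n L φ e ∧ Sat n L ψ e := by
  simp [Sat, eval, and, neg, tt]

theorem sat_imp {φ ψ : Fml ι ρ} : Sat n L (imp φ ψ) e ↔ (Sat n L φ e → Sat n L ψ e) := by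
  simp only [Sat, eval, imp, neg, tt]
  cases φ.eval n L _ <;> cases ψ.eval n L _ <;> simp

theorem sat_or {φ ψ : Fml ι ρ} : Sat n L (or φ ψ) e ↔ Sat n L φ e ∨ Sat n L ψ e := by
  rw [or, sat_imp, sat_neg]
  tauto

theorem sat_iff {φ ψ : Fml ι ρ} : Sat n L (iff φ ψ) e ↔ (Sat n L φ e ↔ Sat n L ψ e) := by
  rw [iff, sat_and, sat_imp, sat_imp]
  tauto

theorem sat_eq {x y : ι} : Sat n L (eq x y : Fml ι ρ) e ↔ e x = e y := by
  rw [eq, sat_and, sat_le, sat_le, le_antisymm_iff]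

theorem countP_range_eq_ncard (p : ℕ → Bool) :
    (List.range n).countP p = {i : Fin n | p i = true}.ncard := by
  have h1 : (List.range n).countP p = ((Finset.range n).filter fun i => p i = true).card := by
    rw [List.countP_eq_length_filter, ← List.toFinset_card_of_nodup (List.nodup_range.filter _)]
    congr 1
    ext
    simp
  rw [h1, ← Set.ncard_coe_finset, ← Set.ncard_image_of_injective _ Fin.val_injective]
  congr 1
  ext i
  simp only [Finset.coe_filter, Finset.mem_range, Set.mem_ofPred_eq, Set.mem_image]
  exact ⟨fun ⟨h, hp⟩ => ⟨⟨i, h⟩, hp, rfl⟩, fun ⟨j, hp, hj⟩ => hj ▸ ⟨j.2, hp⟩⟩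

theorem eval_update {φ : Fml ι ρ} {x : ι} (i : Fin n) :
    φ.eval n L (update (fun z => (e z : ℕ)) x i) = true ↔ Sat n L φ (update e x i) := by
  rw [Sat]
  suffices h : update (fun z => (e z : ℕ)) x i = fun z => (update e x i z : ℕ) by rw [h]
  funext z
  by_cases h : z = x
  · subst h
    simp
  · simp [h]

theorem sat_cntEq {x : ι} {φ ψ : Fml ι ρ} : Sat n L (cntEq x φ ψ) e ↔
    {i : Fin n | Sat n L φ (update e x i)}.ncard =
      {i : Fin n | Sat n L ψ (update e x i)}.ncard := by
  rw [cntEq, sat_and, le_antisymm_iff]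
  simp only [Sat, eval, decide_eq_true_eq, countP_range_eq_ncard]
  simp only [eval_update]
  rfl

theorem sat_all {x : ι} {φ : Fml ι ρ} :
    Sat n L (all x φ) e ↔ ∀ i : Fin n, Sat n L φ (update e x i) := by
  simp only [← eval_update]
  simp only [Sat, all, eval, neg, tt]
  simp [Fin.forall_iff]

theorem sat_ex {x : ι} {φ : Fml ι ρ} :
    Sat n L (ex x φ) e ↔ ∃ i : Fin n, Sat n L φ (update e x i) := by
  rw [ex, sat_neg]
  simp only [← eval_update]
  simp only [Sat, eval]
  simp [Fin.exists_iff]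

end Fml

end StackProgram

/-! ### The formulas of the algorithm. -/

namespace Cograph

open StackProgram StackProgram.Fml Function

/-- The relations used by the algorithm: adjacency, the levels of the decomposition, and
isomorphism of modules. -/
inductive Tab
  | adj | lev | iso
  deriving DecidableEq

instance : Fintype Tab := ⟨{.adj, .lev, .iso}, fun t => by cases t <;> simp⟩

/-- Formulas over the relations used by the algorithm. The variables `0, 1, 2, 3` stand for the
parameters of a candidate. -/
abbrev Frm := Fml (Fin 13) Tab

/-- Membership in the candidate. -/
def sideF (u : Fin 13) : Frm :=
  and (or (tab .adj [0, u]) (tab .adj [1, u])) (and (neg (eq u 2)) (neg (eq u 3)))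

/-- The relation `SameSide`. -/
def sameF (u v : Fin 13) : Frm := iff (sideF u) (sideF v)

/-- The relation `sideRel`. -/
def relF (u v : Fin 13) : Frm :=
  and (neg (eq u v)) (and (sameF u v) (iff (tab .adj [u, v]) (sideF u)))

/-- The table of levels. -/
def levF (j u v : Fin 13) : Frm := tab .lev [0, 1, 2, 3, j, u, v]

/-- The table of isomorphisms. -/
def isoF (j u v : Fin 13) : Frm := tab .iso [0, 1, 2, 3, j, u, v]

/-- The definition of the level `4` at `5` and `6` from the lower ones. -/
def levDef : Frm :=
  and (sameF 5 6) (all 7 (imp (neg (le 4 7)) (and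
    (ex 8 (and (levF 7 5 8) (and (or (eq 5 8) (relF 5 8)) (or (eq 8 6) (relF 8 6)))))
    (ex 8 (and (levF 7 5 8) (and (neg (relF 5 8)) (neg (relF 8 6))))))))

/-- The relation `Sparse` for the levels `4` and `7`. -/
def sparseF (u : Fin 13) : Frm :=
  ex 9 (ex 10 (and (and (levF 4 u 9) (levF 4 u 10)) (and (neg (levF 7 9 10)) (neg (relF 9 10)))))

/-- The definition of the isomorphism relation at level `4` at `5` and `6` from higher levels. -/
def isoDef : Frm :=
  all 7 (imp (neg (le 7 4)) (and (iff (sparseF 5) (sparseF 6))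
    (all 8 (cntEq 9 (and (levF 4 5 9) (isoF 7 9 8)) (and (levF 4 6 9) (isoF 7 9 8))))))

/-- Adjacency across the cut. -/
def cutF (u v : Fin 13) : Frm := and (tab .adj [u, v]) (neg (sameF u v))

/-- The candidate with the parameters `0, 1, 2, 3` is good. -/
def goodF : Frm :=
  and (all 5 (ex 6 (and (cutF 5 6) (all 7 (imp (cutF 5 7) (eq 7 6))))))
    (and (all 5 (all 6 (all 7 (all 8 (imp (and (and (relF 5 6) (relF 6 7)) (relF 7 8))
      (or (or (relF 5 7) (relF 5 8)) (relF 6 8)))))))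
    (all 5 (all 6 (imp (sideF 5) (imp (neg (sideF 6))
      (all 4 (imp (all 7 (le 4 7)) (isoF 4 5 6))))))))

/-- There are no vertices or there is a good candidate. -/
def mainF : Frm := or (neg (ex 0 tt)) (ex 0 (ex 1 (ex 2 (ex 3 goodF))))

/-- The computation of the levels. -/
def levRule : Rule (Fin 13) Tab := ⟨.lev, [0, 1, 2, 3, 4, 5, 6], levDef⟩

/-- The computation of the isomorphism relation. -/
def isoRule : Rule (Fin 13) Tab := ⟨.iso, [0, 1, 2, 3, 4, 5, 6], isoDef⟩

theorem wf_levRule : WFAll levRule.φ levRule.zs [12] := by decide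

theorem wf_isoRule : WFAll isoRule.φ isoRule.zs [12] := by decide

theorem wf_mainF : mainF.WF [] := by decide

end Cograph

/-! ### Correctness of the formulas and of the two iterations. -/

namespace Cograph

open StackProgram StackProgram.Fml Function

/-- Reading a relation of arity seven from its table. -/
def Rel {n : ℕ} (l : List Bool) (x y a b j u v : Fin n) : Prop :=
  l.getD (tupleIdx n 0 [x, y, a, b, j, u, v]) false = true

section

variable {n : ℕ} {G : SimpleGraph (Fin n)} {L : Tab → List Bool} {g : Fin 13 → Fin n}

theorem sat_adj (hL : L .adj = tabList n 2 (adjRel ⟨n, G⟩)) {u v : Fin 13} :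
    Sat n L (tab .adj [u, v]) g ↔ G.Adj (g u) (g v) := by
  rw [sat_tab, hL]
  have := getD_tabList n (adjRel ⟨n, G⟩) [g u, g v] (by simp)
  simp only [List.length_cons, List.length_nil, zero_add, Nat.reduceAdd] at this
  simp only [List.map_cons, List.map_nil]
  rw [this]
  simp [adjRel]

theorem sat_levF {j u v : Fin 13} : Sat n L (levF j u v) g ↔
    Rel (L .lev) (g 0) (g 1) (g 2) (g 3) (g j) (g u) (g v) := Iff.rfl

theorem sat_isoF {j u v : Fin 13} : Sat n L (isoF j u v) g ↔
    Rel (L .iso) (g 0) (g 1) (g 2) (g 3) (g j) (g u) (g v) := Iff.rfl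

theorem sat_sideF (hL : L .adj = tabList n 2 (adjRel ⟨n, G⟩)) {u : Fin 13} :
    Sat n L (sideF u) g ↔ g u ∈ candidate G (g 0) (g 1) (g 2) (g 3) := by
  simp only [sideF, sat_and, sat_or, sat_adj hL, sat_neg, sat_eq]
  rfl

theorem sat_sameF (hL : L .adj = tabList n 2 (adjRel ⟨n, G⟩)) {u v : Fin 13} :
    Sat n L (sameF u v) g ↔ SameSide (candidate G (g 0) (g 1) (g 2) (g 3)) (g u) (g v) := by
  simp only [sameF, sat_iff, sat_sideF hL]
  rfl

theorem sat_relF (hL : L .adj = tabList n 2 (adjRel ⟨n, G⟩)) {u v : Fin 13} :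
    Sat n L (relF u v) g ↔ sideRel G (candidate G (g 0) (g 1) (g 2) (g 3)) (g u) (g v) := by
  simp only [relF, sat_and, sat_iff, sat_sameF hL, sat_sideF hL, sat_neg, sat_eq, sat_adj hL]
  rfl

/-- Unfolds the recursion into a condition on all lower levels, which a formula can state with the
order alone. -/
theorem level_iff {α : Type*} {K E₀ : α → α → Prop} {j : ℕ} {u v : α} :
    level K E₀ j u v ↔ E₀ u v ∧ ∀ i < j, Near K {w | level K E₀ i u w} u v ∧
      CoNear K {w | level K E₀ i u w} u v := by
  induction j with
  | zero => simp [level]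
  | succ j ih =>
    simp only [level]
    rw [ih, Nat.forall_lt_succ_right, and_assoc]

/-- The values of the variables while a rule is applied. -/
def env (x y a b j u v o i : Fin n) : Fin 13 → Fin n := ![x, y, a, b, j, u, v, o, o, o, o, o, i]

theorem rel_stage_succ {R : Rule (Fin 13) Tab} (hz : R.zs = [0, 1, 2, 3, 4, 5, 6]) {i : ℕ}
    (hi : i < n) (x y a b j u v : Fin n) :
    Rel (stage n 12 R L (i + 1) R.r) x y a b j u v ↔
      Sat n (stage n 12 R L i) R.φ (env x y a b j u v ⟨0, by omega⟩ ⟨i, hi⟩) := by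
  rw [Rel, stage, update_self]
  have h := getD_tabList n (fun is => R.φ.eval n (stage n 12 R L i)
    (bindTuple (update (fun _ => 0) 12 i) R.zs is)) [x, y, a, b, j, u, v] (by simp)
  have hl : [(x : ℕ), y, a, b, j, u, v].length = R.zs.length := by rw [hz]; rfl
  rw [hl] at h
  rw [h, hz, Sat]
  suffices h : bindTuple (update (fun _ => 0) 12 i) [0, 1, 2, 3, 4, 5, 6] [↑x, ↑y, ↑a, ↑b, ↑j, ↑u, ↑v]
      = fun z : Fin 13 => (env x y a b j u v ⟨0, by omega⟩ ⟨i, hi⟩ z : ℕ) by rw [h]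
  funext z
  fin_cases z <;> rfl

theorem stage_of_ne {R : Rule (Fin 13) Tab} {r : Tab} (hr : r ≠ R.r) (i : ℕ) :
    stage n 12 R L i r = L r := by
  induction i with
  | zero => rfl
  | succ i ih => rw [stage, update_of_ne hr, ih]

theorem sat_levDef (hL : L .adj = tabList n 2 (adjRel ⟨n, G⟩)) :
    Sat n L levDef g ↔ SameSide (candidate G (g 0) (g 1) (g 2) (g 3)) (g 5) (g 6) ∧ ∀ i < g 4,
      Near (sideRel G (candidate G (g 0) (g 1) (g 2) (g 3)))
        {w | Rel (L .lev) (g 0) (g 1) (g 2) (g 3) i (g 5) w} (g 5) (g 6) ∧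
      CoNear (sideRel G (candidate G (g 0) (g 1) (g 2) (g 3)))
        {w | Rel (L .lev) (g 0) (g 1) (g 2) (g 3) i (g 5) w} (g 5) (g 6) := by
  simp only [levDef, sat_and, sat_sameF hL, sat_all, sat_imp, sat_neg, sat_le, sat_ex, sat_levF,
    sat_or, sat_eq, sat_relF hL, Function.update_apply, Fin.reduceEq, if_true, if_false, not_le]
  rfl

theorem sat_sparseF (hL : L .adj = tabList n 2 (adjRel ⟨n, G⟩)) {u : Fin 13} (h9 : u ≠ 9)
    (h10 : u ≠ 10) : Sat n L (sparseF u) g ↔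
      Sparse (sideRel G (candidate G (g 0) (g 1) (g 2) (g 3)))
        (Rel (L .lev) (g 0) (g 1) (g 2) (g 3) (g 4))
        (Rel (L .lev) (g 0) (g 1) (g 2) (g 3) (g 7)) (g u) := by
  simp only [sparseF, sat_and, sat_neg, sat_ex, sat_levF, sat_relF hL, Function.update_apply,
    Fin.reduceEq, if_true, if_false, h9, h10, and_assoc]
  rfl

theorem sat_isoDef (hL : L .adj = tabList n 2 (adjRel ⟨n, G⟩)) :
    Sat n L isoDef g ↔ ∀ i, g 4 < i →
      (Sparse (sideRel G (candidate G (g 0) (g 1) (g 2) (g 3)))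
          (Rel (L .lev) (g 0) (g 1) (g 2) (g 3) (g 4))
          (Rel (L .lev) (g 0) (g 1) (g 2) (g 3) i) (g 5) ↔
        Sparse (sideRel G (candidate G (g 0) (g 1) (g 2) (g 3)))
          (Rel (L .lev) (g 0) (g 1) (g 2) (g 3) (g 4))
          (Rel (L .lev) (g 0) (g 1) (g 2) (g 3) i) (g 6)) ∧
      ∀ x, {y | Rel (L .lev) (g 0) (g 1) (g 2) (g 3) (g 4) (g 5) y ∧
          Rel (L .iso) (g 0) (g 1) (g 2) (g 3) i y x}.ncard =
        {y | Rel (L .lev) (g 0) (g 1) (g 2) (g 3) (g 4) (g 6) y ∧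
          Rel (L .iso) (g 0) (g 1) (g 2) (g 3) i y x}.ncard := by
  simp only [isoDef, sat_and, sat_all, sat_imp, sat_neg, sat_le, sat_iff,
    sat_sparseF hL (show (5 : Fin 13) ≠ 9 by decide) (by decide),
    sat_sparseF hL (show (6 : Fin 13) ≠ 9 by decide) (by decide), sat_cntEq, sat_levF, sat_isoF,
    Function.update_apply, Fin.reduceEq, if_true, if_false, not_le]

/-- The definition of a level refers only to lower ones, so after `i` rounds all levels below `i`
are right, whatever the table held at first. -/
theorem rel_levRule (hL : L .adj = tabList n 2 (adjRel ⟨n, G⟩)) (x y a b j u v : Fin n) :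
    Rel (stage n 12 levRule L n .lev) x y a b j u v ↔
      level (sideRel G (candidate G x y a b)) (SameSide (candidate G x y a b)) j u v := by
  suffices h : ∀ i ≤ n, ∀ j : Fin n, j < i → ∀ u v,
      (Rel (stage n 12 levRule L i .lev) x y a b j u v ↔
        level (sideRel G (candidate G x y a b)) (SameSide (candidate G x y a b)) j u v) from
    h n le_rfl j j.2 u v
  intro i
  induction i with
  | zero => exact fun _ j hj => absurd hj (Nat.not_lt_zero _)
  | succ i ih =>
    intro hi j hj u v
    have h1 := rel_stage_succ (L := L) (R := levRule) rfl hi x y a b j u v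
    have h2 : stage n 12 levRule L i .adj = tabList n 2 (adjRel ⟨n, G⟩) := by
      rw [stage_of_ne (by decide), hL]
    refine h1.trans ((sat_levDef h2).trans ?_)
    rw [level_iff]
    change _ ∧ (∀ k < j, Near (sideRel G (candidate G x y a b))
        {w | Rel (stage n 12 levRule L i .lev) x y a b k u w} u v ∧
      CoNear (sideRel G (candidate G x y a b))
        {w | Rel (stage n 12 levRule L i .lev) x y a b k u w} u v) ↔ _
    refine and_congr Iff.rfl (Fin.forall_iff.trans (forall_congr' fun k => ?_))
    refine ⟨fun h hk => ?_, fun h hk hkj => ?_⟩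
    · simpa only [ih (by omega) ⟨k, hk.trans j.2⟩ (by simp; omega)] using h (hk.trans j.2) hk
    · have hkj : k < j := hkj
      simpa only [ih (by omega) ⟨k, hk⟩ (by simp; omega)] using h hkj

/-- The isomorphism relation on modules at all levels. -/
theorem rel_isoRule (hL : L .adj = tabList n 2 (adjRel ⟨n, G⟩)) {x y a b : Fin n}
    (hlev : ∀ j u v, Rel (L .lev) x y a b j u v ↔
      level (sideRel G (candidate G x y a b)) (SameSide (candidate G x y a b)) j u v)
    (hP : P4Free (sideRel G (candidate G x y a b))) (j u v : Fin n) :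
    Rel (stage n 12 isoRule L n .iso) x y a b j u v ↔
      ClassIso (sideRel G (candidate G x y a b))
        (level (sideRel G (candidate G x y a b)) (SameSide (candidate G x y a b)) j) u v := by
  set K := sideRel G (candidate G x y a b) with hK
  set E := SameSide (candidate G x y a b) with hE
  have hlev' : ∀ j : Fin n, Rel (L .lev) x y a b j = level K E j := by
    intro j
    ext u v
    exact hlev j u v
  let T := fun i (j u v : Fin n) => Rel (stage n 12 isoRule L i .iso) x y a b j u v
  let F := fun (J : Fin n → Fin n → Fin n → Prop) (j u v : Fin n) => ∀ i, j < i →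
    (Sparse K (level K E j) (level K E i) u ↔ Sparse K (level K E j) (level K E i) v) ∧
      ∀ x, {y | level K E j u y ∧ J i y x}.ncard = {y | level K E j v y ∧ J i y x}.ncard
  have hstep : ∀ i < n, T (i + 1) = F (T i) := by
    intro i hi
    ext j u v
    have h2 : stage n 12 isoRule L i .adj = tabList n 2 (adjRel ⟨n, G⟩) := by
      rw [stage_of_ne (by decide), hL]
    have h3 : stage n 12 isoRule L i .lev = L .lev := stage_of_ne (by decide) i
    refine (rel_stage_succ (L := L) (R := isoRule) rfl hi x y a b j u v).trans
      ((sat_isoDef h2).trans ?_)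
    rw [h3]
    simp only [F, T, ← hlev']
    rfl
  -- The isomorphism table stabilises from the deepest level upwards: a level depends only on larger
  -- ones, so `i` rounds settle the last `i` levels.
  have hfix : ∀ i ≤ n, ∀ j : Fin n, n ≤ j + i → T i j = F (T i) j := by
    intro i
    induction i with
    | zero => exact fun _ j hj => absurd j.2 (by omega)
    | succ i ih =>
      intro hi j hj
      have h : ∀ k, j < k → T (i + 1) k = T i k := fun k hk => by
        have hk' : (j : ℕ) < k := hk
        rw [hstep i hi, ← ih (by omega) k (by omega)]
      conv_lhs => rw [hstep i hi]
      ext u v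
      refine forall_congr' fun k => imp_congr_right fun hk => ?_
      rw [h k hk]
  have := test_iff_classIso (sideRel_symm _) (sideRel_irrefl _) hP (sameSide_equivalence _)
    (fun j u v => ∃ h : j < n, T n ⟨j, h⟩ u v) (by
      intro j hj u v
      rw [Nat.card_fin] at hj ⊢
      simp only [hj, exists_true_left]
      rw [hfix n le_rfl ⟨j, hj⟩ (by simp)]
      simp only [F, Fin.forall_iff, Fin.mk_lt_mk]
      refine forall_congr' fun i => ⟨fun h hji hi => ?_, fun h hi hji => ?_⟩
      · simpa only [hi, exists_true_left] using h hi hji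
      · simpa only [hi, exists_true_left] using h hji hi)
    (j := j) (by rw [Nat.card_fin]; exact j.2) u v
  simpa using this

theorem sat_cutF (hL : L .adj = tabList n 2 (adjRel ⟨n, G⟩)) {u v : Fin 13} :
    Sat n L (cutF u v) g ↔
      G.Adj (g u) (g v) ∧ ¬ SameSide (candidate G (g 0) (g 1) (g 2) (g 3)) (g u) (g v) := by
  rw [cutF, sat_and, sat_adj hL, sat_neg, sat_sameF hL]

/-- The isomorphism table is trusted only for candidates without induced four-vertex paths. This
suffices, since the formula also demands that property and fails for all others. -/
theorem sat_goodF (hL : L .adj = tabList n 2 (adjRel ⟨n, G⟩))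
    (hiso : P4Free (sideRel G (candidate G (g 0) (g 1) (g 2) (g 3))) → ∀ j u v,
      (Rel (L .iso) (g 0) (g 1) (g 2) (g 3) j u v ↔
        ClassIso (sideRel G (candidate G (g 0) (g 1) (g 2) (g 3)))
          (level (sideRel G (candidate G (g 0) (g 1) (g 2) (g 3)))
            (SameSide (candidate G (g 0) (g 1) (g 2) (g 3))) j) u v)) :
    Sat n L goodF g ↔ Good G (candidate G (g 0) (g 1) (g 2) (g 3)) := by
  simp only [goodF, sat_and, sat_all, sat_ex, sat_imp, sat_or, sat_neg, sat_cutF hL, sat_relF hL,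
    sat_sideF hL, sat_isoF, sat_le, sat_eq, Function.update_apply, Fin.reduceEq, if_true, if_false]
  have hP : (∀ p q r s, (sideRel G (candidate G (g 0) (g 1) (g 2) (g 3)) p q ∧
        sideRel G (candidate G (g 0) (g 1) (g 2) (g 3)) q r) ∧
        sideRel G (candidate G (g 0) (g 1) (g 2) (g 3)) r s →
      (sideRel G (candidate G (g 0) (g 1) (g 2) (g 3)) p r ∨
        sideRel G (candidate G (g 0) (g 1) (g 2) (g 3)) p s) ∨
        sideRel G (candidate G (g 0) (g 1) (g 2) (g 3)) q s) ↔
      P4Free (sideRel G (candidate G (g 0) (g 1) (g 2) (g 3))) := by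
    refine forall_congr' fun p => forall_congr' fun q => forall_congr' fun r =>
      forall_congr' fun s => ?_
    tauto
  rw [hP]
  -- The least element is level `0`, whose classes are the two sides.
  have h0 : ∀ j : Fin n, (∀ k, j ≤ k) → (j : ℕ) = 0 := fun j hj =>
    Nat.le_zero.1 (hj ⟨0, by have := j.2; omega⟩)
  constructor
  · rintro ⟨h1, h2, h3⟩
    refine ⟨fun u => ?_, h2, fun u hu v hv => ?_⟩
    · obtain ⟨v, hv, h⟩ := h1 u
      exact ⟨v, hv, h⟩
    · have hn : 0 < n := by have := u.2; omega
      exact (hiso h2 ⟨0, hn⟩ u v).1 (h3 u v hu hv ⟨0, hn⟩ fun k => Nat.zero_le _)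
  · rintro ⟨h1, h2, h3⟩
    refine ⟨fun u => ?_, h2, fun u v hu hv j hj => ?_⟩
    · obtain ⟨v, hv, h⟩ := h1 u
      exact ⟨v, hv, h⟩
    · rw [hiso h2, h0 j hj]
      exact h3 u hu v hv

theorem sat_mainF (hL : L .adj = tabList n 2 (adjRel ⟨n, G⟩))
    (hiso : ∀ x y a b, P4Free (sideRel G (candidate G x y a b)) → ∀ j u v,
      (Rel (L .iso) x y a b j u v ↔ ClassIso (sideRel G (candidate G x y a b))
          (level (sideRel G (candidate G x y a b)) (SameSide (candidate G x y a b)) j) u v)) :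
    Sat n L mainF g ↔ HasCographDecomposition G := by
  rw [hasCographDecomposition_iff, mainF, sat_or, sat_neg, sat_ex]
  simp only [sat_ex, sat_tt, sat_goodF hL (hiso _ _ _ _), Function.update_apply, Fin.reduceEq,
    if_true, if_false, exists_const_iff, and_true, not_nonempty_iff]

end

theorem eval_mainF (G : InputGraph) :
    mainF.eval G.1 (applyRules G.1 12 [levRule, isoRule]
      (update (fun _ => []) .adj (tabList G.1 2 (adjRel G)))) (fun _ => 0) = true ↔
      HasCographDecomposition G.2 := by
  obtain ⟨n, G⟩ := G
  -- `Sat` needs values in `Fin n` for all variables, so the graph without vertices is treated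
  -- separately.
  rcases Nat.eq_zero_or_pos n with rfl | hn
  · rw [hasCographDecomposition_iff]
    simp [mainF, Fml.or, Fml.imp, Fml.neg, Fml.tt, Fml.ex, Fml.eval]
    infer_instance
  set L₀ : Tab → List Bool := update (fun _ => []) .adj (tabList n 2 (adjRel ⟨n, G⟩))
  have h0 : L₀ .adj = tabList n 2 (adjRel ⟨n, G⟩) := update_self ..
  set L₁ := stage n 12 levRule L₀ n with hL₁
  have h1 : L₁ .adj = tabList n 2 (adjRel ⟨n, G⟩) := by
    rw [hL₁, stage_of_ne (by decide), h0]
  set L₂ := stage n 12 isoRule L₁ n with hL₂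
  have h2 : L₂ .adj = tabList n 2 (adjRel ⟨n, G⟩) := by
    rw [hL₂, stage_of_ne (by decide), h1]
  exact sat_mainF (g := fun _ => ⟨0, hn⟩) h2 fun x y a b hP j u v =>
    rel_isoRule h1 (rel_levRule h0 x y a b) hP j u v

end Cograph

theorem lemma1 :
    PolyTimeDecidable encodeGraph (fun G : InputGraph => HasCographDecomposition G.2) := by
  refine StackProgram.polyTimeDecidable_of_rules .adj 12 [Cograph.levRule, Cograph.isoRule]
    Cograph.mainF ?_ Cograph.wf_mainF _ ?_
  · intro R hR
    rcases List.mem_pair.1 hR with rfl | rfl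
    · exact Cograph.wf_levRule
    · exact Cograph.wf_isoRule
  · exact Cograph.eval_mainF
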